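/- **Setting.** Let $\mathcal X$ be a topological space and $\mu$ a Radon measure on $\mathcal X$ with support $\mathcal X$ (only that $\mu$ is a Borel measure with full support is needed). Let $I\subset(0,\infty)$ be an open interval, $\tau\in C^\infty(I)$ with $\tau'>0$, and $h\in C^\infty(\tau(I))$ with $h''>0$. Put $$\ell_{h,\tau}=h'\circ\tau,\quad \chi_{h,\tau}=1/\ell_{h,\tau}',\quad d_{h,\tau}(t,s)=h(\tau(t))-h(\tau(s))-(\tau(t)-\tau(s))h'(\tau(s)),$$ and let $\exp_{h,\tau}$ be the inverse of $\ell_{h,\tau}\colon I\to\ell_{h,\tau}(I)$, extended to $\mathbb R$ by $\infty$ above and by $0$ below $\ell_{h,\tau}(I)$. Let $\mathcal M$ be a connected, second countable, Hausdorff smooth manifold of dimension $n\ge 1$ whose points are pairwise distinct elements $p$ of $L^1(\mu)$, represented by functions $p\colon\mathcal X\to(0,\infty)$, with $p\in I$ $\mu$-a.e. and $\int p\,d\mu=1$. Write $e_x(p)=p(x)$. $\mathcal M$ is a *statistical model* if there is a $\mu$-null set $\mathcal N$ such that the topology of $\mathcal M$ is induced by $(e_x)_{x\notin\mathcal N}$,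 each $e_x$ with $x\notin\mathcal N$ is smooth, the derivatives of $e_x$ of every order at a given point are Borel in $x\notin\mathcal N$, and a tangent vector $V_p$ vanishes iff $V_p(e_x)=0$ for all $x\notin\mathcal N$; and if moreover, for all smooth vector fields $V,W$ and all $p$, the functions $x\mapsto V_p(e_x)$ and $x\mapsto V_p(We_x)$ are $\mu$-integrable with integral $0$. An $\exp_{h,\tau}$-*coordinate representation* $(U,\theta,T,c,\psi)$ consists of a coordinate system $(U,\theta)$ of $\mathcal M$, continuous maps $T\colon\mathcal X\to\mathbb R^n$ and $c\colon\mathcal X\to\mathbb R$, and $\psi\in C^\infty(U)$ with $$p(x)=\exp_{h,\tau}(\langle\theta(p),T(x)\rangle-c(x)-\psi(p))\qquad(p\in U,\ x\in\mathcal X).$$ If $U=\mathcal M$, the representation is global and $\psi$ is called a *global normalization*. An $\exp_{h,\tau}$-*family* is a statistical model each of whose points lies in the domain $U$ of such a representation. For a vector field $V$ put $\widetilde V=(V,0)$ and $\widehat V=(0,V)$ on $\mathcal M\times\mathcal M$. $\mathcal M$ is $(h,\tau)$-*compatible* if, for all smooth vector fields $V,W,Z$, the integrands in $$g^{h,\tau}_p(V,W)=-\int_{\mathcal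 X}\widetilde V_{(p,p)}\big(\widehat W(d_{h,\tau}\circ(e_x,e_x))\big)d\mu(x),\qquad g^{h,\tau}_p(\nabla^{h,\tau}_ZV,W)=-\int_{\mathcal X}\widehat Z_{(p,p)}\big(\widehat V\widetilde W(d_{h,\tau}\circ(e_x,e_x))\big)d\mu(x)$$ are integrable for every $p\in\mathcal M$ and both expressions are smooth in $p$. Finally let $$\mathbb I_\tau(p)=\int_{\mathcal X}\tau(p(x))\,d\mu(x),\qquad D_{h,\tau}(p,p')=\int_{\mathcal X}d_{h,\tau}(p(x),p'(x))\,d\mu(x)\in[0,\infty].$$ **Proposition 5.6.** Let $\mathcal M$ be an $(h,\tau)$-compatible $\exp_{h,\tau}$-family, and suppose that $\tau/\chi_{h,\tau}$ is equal to a positive constant on $I$. 1. $\mathbb I_\tau$ is well defined (finite), smooth and positive on $\mathcal M$. 2. Assume $V_p(\mathbb I_\tau)=\int_{\mathcal X}V_p(\tau\circ e_x)\,d\mu(x)$ for all smooth vector fields $V$ and all $p\in\mathcal M$. Then $g^{h,\tau}$ is a Riemannian metric and $\nabla^{h,\tau}$ a connection; and if the Riemannian metric $\overline g$ and the connection $\overline\nabla$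 are defined by $$\overline g=\frac1{\mathbb I_\tau}g^{h,\tau},\qquad \overline g(\overline\nabla_VW,Z)=\overline g(\nabla^{h,\tau}_VW,Z)-Z\Big(\log\frac1{\mathbb I_\tau}\Big)\overline g(V,W),$$ then $(\overline g,\overline\nabla)$ is a Hessian structure, that is, $\overline\nabla$ has vanishing torsion and curvature and locally $\overline g=\overline\nabla d\Psi$ for a smooth function $\Psi$ (a potential). Global $\exp_{h,\tau}$-coordinate representations exist, and every global normalization $\psi$ is a global potential: $\overline g=\overline\nabla d\psi$ on $\mathcal M$. 3. $D_{h,\tau}$ is a contrast function on $\mathcal M$: it is finite, smooth on $\mathcal M\times\mathcal M$, nonnegative, and zero exactly on the diagonal. Under the assumption of 2, the canonical divergence of $(\overline g,\overline\nabla)$ on $\mathcal M$, i.e. $\overline D(p,p')=\Psi(p')-\Psi(p)+\langle\xi(p)-\xi(p'),\eta(p)\rangle$ for a global coordinate system $\xi$ that is affine with respect to $\overline\nabla$ (all Christoffel symbols vanish), a global potential $\Psi$ and $\eta=(\partial\Psi/\partial\xi^i)_{i=1}^n$, exists, does not depend on the choice of $\xi$ and $\Psi$, and is given by $$\overline D(p,p')=\frac1{\mathbb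 I_\tau(p)}D_{h,\tau}(p,p').$$ -/

import Mathlib

open MeasureTheory Set
open scoped Manifold ContDiff

noncomputable section

namespace DeformedExp

/-! ### The functions attached to a triple `(h, τ, I)` -/

/-- The triple `(h, τ, I)` is admissible: `I ⊆ (0, ∞)` is an open interval, `τ ∈ C^∞(I)` with
`τ' > 0` on `I`, and `h ∈ C^∞(τ(I))` with `h'' > 0` on `τ(I)`.
(The functions are given on all of `ℝ`; only their values on `I`, resp. `τ(I)`, matter.) -/
structure IsAdmissible (h τ : ℝ → ℝ) (I : Set ℝ) : Prop where
  isOpen : IsOpen I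
  ordConnected : I.OrdConnected
  subset_pos : I ⊆ Ioi 0
  smooth_tau : ContDiffOn ℝ ∞ τ I
  deriv_tau_pos : ∀ t ∈ I, 0 < deriv τ t
  smooth_h : ContDiffOn ℝ ∞ h (τ '' I)
  deriv_deriv_h_pos : ∀ r ∈ τ '' I, 0 < deriv (deriv h) r

/-- `d_{h,τ}(t, s) = h(τ(t)) - h(τ(s)) - (τ(t) - τ(s)) h'(τ(s))`. -/
def dFun (h τ : ℝ → ℝ) (t s : ℝ) : ℝ :=
  h (τ t) - h (τ s) - (τ t - τ s) * deriv h (τ s)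

/-- `ℓ_{h,τ} = h' ∘ τ`. -/
def ellFun (h τ : ℝ → ℝ) (t : ℝ) : ℝ := deriv h (τ t)

/-- `χ_{h,τ} = 1 / ℓ_{h,τ}'`. -/
def chiFun (h τ : ℝ → ℝ) (t : ℝ) : ℝ := 1 / deriv (ellFun h τ) t

open Classical in
/-- The `(h, τ)`-exponential function: the inverse function of `ℓ_{h,τ} : I → ℓ_{h,τ}(I)`, extended
by `∞` above the interval `ℓ_{h,τ}(I)` and by `0` below it. -/
def defExp (h τ : ℝ → ℝ) (I : Set ℝ) (u : ℝ) : EReal :=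
  if u ∈ ellFun h τ '' I then ((Function.invFunOn (ellFun h τ) I u : ℝ) : EReal)
  else if ∀ v ∈ ellFun h τ '' I, v ≤ u then ⊤
  else 0

variable {n : ℕ} {M : Type*} [TopologicalSpace M] [ChartedSpace (EuclideanSpace ℝ (Fin n)) M]
  [IsManifold (𝓡 n) ∞ M]

/-! ### Vector fields acting on functions -/

/-- `V` is a smooth vector field on `M`. -/
def IsSmoothVF (V : ∀ p : M, TangentSpace (𝓡 n) p) : Prop :=
  ContMDiff (𝓡 n) (𝓡 n).tangent ∞ (fun p => (⟨p, V p⟩ : TangentBundle (𝓡 n) M))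

/-- The function `V f`, the derivative of `f` along the vector field `V`. -/
def dir (V : ∀ p : M, TangentSpace (𝓡 n) p) (f : M → ℝ) : M → ℝ :=
  fun p => mvfderiv (𝓡 n) f p (V p)

/-- The derivative of `F : M × M → ℝ` along the vector field `(V, 0)` on `M × M`. -/
def dirFst (V : ∀ p : M, TangentSpace (𝓡 n) p) (F : M × M → ℝ) : M × M → ℝ :=
  fun z => dir V (fun p => F (p, z.2)) z.1

/-- The derivative of `F : M × M → ℝ` along the vector field `(0, V)` on `M × M`. -/
def dirSnd (V : ∀ p : M, TangentSpace (𝓡 n) p) (F : M × M → ℝ) : M × M → ℝ :=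
  fun z => dir V (fun q => F (z.1, q)) z.2

/-! ### Hessian structures -/

/-- A smooth Riemannian metric on `M`. -/
abbrev Metric (n : ℕ) (M : Type*) [TopologicalSpace M]
    [ChartedSpace (EuclideanSpace ℝ (Fin n)) M] [IsManifold (𝓡 n) ∞ M] : Type _ :=
  Bundle.ContMDiffRiemannianMetric (𝓡 n) ∞ (EuclideanSpace ℝ (Fin n))
    (fun p : M => TangentSpace (𝓡 n) p)

/-- A connection on (the tangent bundle of) `M`; `∇_V W` at `p` is `conn W p (V p)`. -/
abbrev Conn (n : ℕ) (M : Type*) [TopologicalSpace M]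
    [ChartedSpace (EuclideanSpace ℝ (Fin n)) M] [IsManifold (𝓡 n) ∞ M] : Type _ :=
  CovariantDerivative (𝓡 n) (EuclideanSpace ℝ (Fin n)) (fun p : M => TangentSpace (𝓡 n) p)

/-- The coordinate vector field `∂_i` of the chart `φ` (meaningful on the source of `φ`). -/
def coordVF (φ : OpenPartialHomeomorph M (EuclideanSpace ℝ (Fin n))) (i : Fin n) :
    ∀ p : M, TangentSpace (𝓡 n) p :=
  fun p => (mvfderiv (𝓡 n) φ p).inverse (EuclideanSpace.single i (1 : ℝ))

/-- The connection is flat: its torsion and its curvature vanish. -/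
structure IsFlat (conn : Conn n M) : Prop where
  torsion_eq_zero : ∀ V W : ∀ p : M, TangentSpace (𝓡 n) p, IsSmoothVF V → IsSmoothVF W →
    ∀ p, conn W p (V p) - conn V p (W p) - VectorField.mlieBracket (𝓡 n) V W p = 0
  curvature_eq_zero : ∀ V W Z : ∀ p : M, TangentSpace (𝓡 n) p,
    IsSmoothVF V → IsSmoothVF W → IsSmoothVF Z → ∀ p,
      conn (fun q => conn Z q (W q)) p (V p) - conn (fun q => conn Z q (V q)) p (W p)
        - conn Z p (VectorField.mlieBracket (𝓡 n) V W p) = 0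

/-- `g = ∇ d Ψ` on the open set `U`, where `Ψ` is smooth on `U` and
`(∇ d Ψ)(V, W) = V (W Ψ) - (∇_V W) Ψ`. -/
structure IsPotentialOn (g : Metric n M) (conn : Conn n M) (Ψ : M → ℝ) (U : Set M) : Prop where
  smooth : ContMDiffOn (𝓡 n) 𝓘(ℝ) ∞ Ψ U
  eq_hess : ∀ V W : ∀ p : M, TangentSpace (𝓡 n) p, IsSmoothVF V → IsSmoothVF W → ∀ p ∈ U,
    g.inner p (V p) (W p) = dir V (dir W Ψ) p - mvfderiv (𝓡 n) Ψ p (conn W p (V p))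

/-- `(g, ∇)` is a Hessian structure: `∇` is a (smooth) flat connection and locally `g = ∇ d Ψ`. -/
structure IsHessianStructure (g : Metric n M) (conn : Conn n M) : Prop where
  smooth : CovariantDerivative.ContMDiffCovariantDerivative conn ∞
  flat : IsFlat conn
  exists_potential : ∀ p : M, ∃ U : Set M, IsOpen U ∧ p ∈ U ∧ ∃ Ψ : M → ℝ,
    IsPotentialOn g conn Ψ U

/-- `(g', ∇')` is 1-conformally equivalent to `(g, ∇)` with 1-conformal factor `ζ`. -/
structure IsOneConformal (ζ : M → ℝ) (g : Metric n M) (conn : Conn n M)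
    (g' : Metric n M) (conn' : Conn n M) : Prop where
  smooth : ContMDiff (𝓡 n) 𝓘(ℝ) ∞ ζ
  pos : ∀ p, 0 < ζ p
  metric_eq : ∀ p (v w : TangentSpace (𝓡 n) p), g'.inner p v w = ζ p * g.inner p v w
  conn_eq : ∀ V W Z : ∀ p : M, TangentSpace (𝓡 n) p,
    IsSmoothVF V → IsSmoothVF W → IsSmoothVF Z → ∀ p,
      g'.inner p (conn' W p (V p)) (Z p)
        = g'.inner p (conn W p (V p)) (Z p)
          - dir Z (fun q => Real.log (ζ q)) p * g'.inner p (V p) (W p)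

/-- The coordinate system `φ` is affine with respect to the connection: it is a chart of the smooth
structure and all the Christoffel symbols vanish, i.e. `∇_{∂_i} ∂_j = 0` on the source of `φ`. -/
structure IsAffineChart (conn : Conn n M)
    (φ : OpenPartialHomeomorph M (EuclideanSpace ℝ (Fin n))) : Prop where
  mem_atlas : φ ∈ IsManifold.maximalAtlas (𝓡 n) ∞ M
  christoffel_eq_zero : ∀ i j : Fin n, ∀ p ∈ φ.source,
    conn (coordVF φ j) p (coordVF φ i p) = 0

/-- `D` is the canonical divergence on `M` of the Hessian structure `(g, ∇)`: for a global affine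
coordinate system `ξ` and a global potential `Ψ`, with `η = (∂_i Ψ)_i`, one has
`D(p, p') = Ψ(p') - Ψ(p) + ⟨ξ(p) - ξ(p'), η(p)⟩`. -/
def IsCanonicalDivergence (g : Metric n M) (conn : Conn n M) (D : M → M → ℝ) : Prop :=
  ∃ (ξ : OpenPartialHomeomorph M (EuclideanSpace ℝ (Fin n))) (Ψ : M → ℝ),
    IsAffineChart conn ξ ∧ ξ.source = univ ∧ IsPotentialOn g conn Ψ univ ∧
    ∀ p p' : M, D p p' = Ψ p' - Ψ p +
      inner ℝ (ξ p - ξ p') (WithLp.toLp 2 fun i => mvfderiv (𝓡 n) Ψ p (coordVF ξ i p))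

/-! ### Contrast functions -/

/-- A contrast function on `M`: a smooth function on `M × M` with values in `[0, ∞)` that vanishes
exactly on the diagonal. The function `D` is a priori `[0, ∞]`-valued. -/
structure IsContrastFunction (n : ℕ) {M : Type*} [TopologicalSpace M]
    [ChartedSpace (EuclideanSpace ℝ (Fin n)) M] (D : M → M → ENNReal) : Prop where
  ne_top : ∀ p p', D p p' ≠ ⊤
  eq_zero_iff : ∀ p p', D p p' = 0 ↔ p = p'
  smooth : ContMDiff ((𝓡 n).prod (𝓡 n)) 𝓘(ℝ) ∞ (fun z : M × M => (D z.1 z.2).toReal)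

/-! ### Statistical models

A manifold in `𝒫_I(μ)` is a manifold `M` with a map `dens : M → (X → ℝ)`; `dens p` is the
probability density that the point `p` is, and `fun p => dens p x` is the evaluation function
`e_x`. -/

variable {X : Type*} [MeasurableSpace X]

/-- `M` is (via `dens`) a set of probability densities in `𝒫_I(μ)`: distinct points of `M` are
distinct elements of `L¹(μ)`, and the evaluation functions have values in `(0, ∞)`. -/
structure IsDensityFamily (μ : Measure X) (I : Set ℝ) (dens : M → X → ℝ) : Prop where
  pos : ∀ p x, 0 < dens p x
  mem : ∀ p, ∀ᵐ x ∂μ, dens p x ∈ I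
  integrable : ∀ p, Integrable (dens p) μ
  integral_eq_one : ∀ p, ∫ x, dens p x ∂μ = 1
  injective : ∀ p p', dens p =ᵐ[μ] dens p' → p = p'

/-- `M` is (via `dens`) a statistical model in `𝒫_I(μ)`. -/
structure IsStatisticalModel (n : ℕ) {M : Type*} [TopologicalSpace M]
    [ChartedSpace (EuclideanSpace ℝ (Fin n)) M] [IsManifold (𝓡 n) ∞ M] (μ : Measure X) (I : Set ℝ)
    (dens : M → X → ℝ) : Prop extends IsDensityFamily μ I dens where
  exists_null : ∃ N : Set X, μ N = 0 ∧
    -- the topology of `M` is induced by the evaluation functions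
    (‹TopologicalSpace M› = ⨅ x : ↥Nᶜ,
      TopologicalSpace.induced (fun p : M => dens p x) (inferInstance : TopologicalSpace ℝ)) ∧
    -- the evaluation functions are smooth
    (∀ x ∉ N, ContMDiff (𝓡 n) 𝓘(ℝ) ∞ (fun p : M => dens p x)) ∧
    -- all derivatives `V₁ (V₂ (⋯ (V_k e_x)))` at `p` are Borel functions of `x`
    (∀ Vs : List (∀ p : M, TangentSpace (𝓡 n) p), (∀ V ∈ Vs, IsSmoothVF V) → ∀ p : M,
      Measurable (fun x : ↥Nᶜ => Vs.foldr dir (fun q => dens q x) p)) ∧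
    -- a tangent vector that annihilates all evaluation functions vanishes
    (∀ (p : M) (v : TangentSpace (𝓡 n) p),
      (∀ x ∉ N, mvfderiv (𝓡 n) (fun q => dens q x) p v = 0) ↔ v = 0)
  integrable_dir : ∀ (p : M) (v : TangentSpace (𝓡 n) p),
    Integrable (fun x => mvfderiv (𝓡 n) (fun q => dens q x) p v) μ
  integral_dir : ∀ (p : M) (v : TangentSpace (𝓡 n) p),
    ∫ x, mvfderiv (𝓡 n) (fun q => dens q x) p v ∂μ = 0
  integrable_dir_dir : ∀ W : ∀ p : M, TangentSpace (𝓡 n) p, IsSmoothVF W →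
    ∀ (p : M) (v : TangentSpace (𝓡 n) p),
      Integrable (fun x => mvfderiv (𝓡 n) (dir W (fun q => dens q x)) p v) μ
  integral_dir_dir : ∀ W : ∀ p : M, TangentSpace (𝓡 n) p, IsSmoothVF W →
    ∀ (p : M) (v : TangentSpace (𝓡 n) p),
      ∫ x, mvfderiv (𝓡 n) (dir W (fun q => dens q x)) p v ∂μ = 0

/-! ### Deformed exponential families -/

/-- `(U, θ, T, c, ψ)` is an `(h, τ)`-exponential coordinate representation on `M`, where the
coordinate system `(U, θ)` is given as the chart `θ` with source `U`. -/
structure IsExpCoordRep [TopologicalSpace X] (h τ : ℝ → ℝ) (I : Set ℝ) (dens : M → X → ℝ)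
    (θ : OpenPartialHomeomorph M (EuclideanSpace ℝ (Fin n)))
    (T : X → EuclideanSpace ℝ (Fin n)) (c : X → ℝ) (ψ : M → ℝ) : Prop where
  mem_atlas : θ ∈ IsManifold.maximalAtlas (𝓡 n) ∞ M
  continuous_T : Continuous T
  continuous_c : Continuous c
  smooth_psi : ContMDiffOn (𝓡 n) 𝓘(ℝ) ∞ ψ θ.source
  dens_eq : ∀ p ∈ θ.source, ∀ x : X,
    ((dens p x : ℝ) : EReal) = defExp h τ I (inner ℝ (θ p) (T x) - c x - ψ p)

/-- `M` is an `(h, τ)`-exponential family in `𝒫_I(μ)`. -/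
structure IsExpFamily (n : ℕ) {M : Type*} [TopologicalSpace M]
    [ChartedSpace (EuclideanSpace ℝ (Fin n)) M] [IsManifold (𝓡 n) ∞ M] [TopologicalSpace X] (μ : Measure X)
    (h τ : ℝ → ℝ) (I : Set ℝ) (dens : M → X → ℝ) : Prop
    extends IsStatisticalModel n μ I dens where
  exists_rep : ∀ p : M, ∃ (θ : OpenPartialHomeomorph M (EuclideanSpace ℝ (Fin n)))
    (T : X → EuclideanSpace ℝ (Fin n)) (c : X → ℝ) (ψ : M → ℝ),
    IsExpCoordRep h τ I dens θ T c ψ ∧ p ∈ θ.source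

/-! ### The divergence and the geometric structure it induces -/

/-- `𝕀_φ(p) = ∫ φ(p(x)) dμ(x)`. -/
def meanFun (μ : Measure X) (dens : M → X → ℝ) (φ : ℝ → ℝ) (p : M) : ℝ :=
  ∫ x, φ (dens p x) ∂μ

/-- The `(h, τ)`-divergence `D_{h,τ}(p, p') = ∫ d_{h,τ}(p(x), p'(x)) dμ(x) ∈ [0, ∞]`. -/
def divergence (μ : Measure X) (h τ : ℝ → ℝ) (dens : M → X → ℝ) (p p' : M) : ENNReal :=
  ∫⁻ x, ENNReal.ofReal (dFun h τ (dens p x) (dens p' x)) ∂μ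

/-- The function `d_{h,τ} ∘ (e_x, e_x)` on `M × M`. -/
def dEval (h τ : ℝ → ℝ) (dens : M → X → ℝ) (x : X) : M × M → ℝ :=
  fun z => dFun h τ (dens z.1 x) (dens z.2 x)

/-- `g^{h,τ}_p(V, W) = -∫ (V, 0)_{(p,p)} ((0, W) (d_{h,τ} ∘ (e_x, e_x))) dμ(x)`. -/
def gForm (μ : Measure X) (h τ : ℝ → ℝ) (dens : M → X → ℝ)
    (V W : ∀ p : M, TangentSpace (𝓡 n) p) (p : M) : ℝ :=
  -∫ x, dirFst V (dirSnd W (dEval h τ dens x)) (p, p) ∂μ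

/-- `g^{h,τ}_p(∇^{h,τ}_Z V, W)
  = -∫ (0, Z)_{(p,p)} ((0, V) ((W, 0) (d_{h,τ} ∘ (e_x, e_x)))) dμ(x)`. -/
def connForm (μ : Measure X) (h τ : ℝ → ℝ) (dens : M → X → ℝ)
    (Z V W : ∀ p : M, TangentSpace (𝓡 n) p) (p : M) : ℝ :=
  -∫ x, dirSnd Z (dirSnd V (dirFst W (dEval h τ dens x))) (p, p) ∂μ

/-- `M` is `(h, τ)`-compatible. -/
structure IsCompatible (n : ℕ) {M : Type*} [TopologicalSpace M]
    [ChartedSpace (EuclideanSpace ℝ (Fin n)) M] [IsManifold (𝓡 n) ∞ M] (μ : Measure X) (h τ : ℝ → ℝ)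
    (dens : M → X → ℝ) : Prop where
  integrable_metric : ∀ V W : ∀ p : M, TangentSpace (𝓡 n) p, IsSmoothVF V → IsSmoothVF W →
    ∀ p, Integrable (fun x => dirFst V (dirSnd W (dEval h τ dens x)) (p, p)) μ
  integrable_conn : ∀ Z V W : ∀ p : M, TangentSpace (𝓡 n) p,
    IsSmoothVF Z → IsSmoothVF V → IsSmoothVF W →
    ∀ p, Integrable (fun x => dirSnd Z (dirSnd V (dirFst W (dEval h τ dens x))) (p, p)) μ
  smooth_metric : ∀ V W : ∀ p : M, TangentSpace (𝓡 n) p, IsSmoothVF V → IsSmoothVF W →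
    ContMDiff (𝓡 n) 𝓘(ℝ) ∞ (gForm μ h τ dens V W)
  smooth_conn : ∀ Z V W : ∀ p : M, TangentSpace (𝓡 n) p,
    IsSmoothVF Z → IsSmoothVF V → IsSmoothVF W →
    ContMDiff (𝓡 n) 𝓘(ℝ) ∞ (connForm μ h τ dens Z V W)

/-- `(g, ∇)` is the pair `(g^{h,τ}, ∇^{h,τ})` of a Riemannian metric and a (smooth) connection. -/
structure IsInducedPair (μ : Measure X) (h τ : ℝ → ℝ) (dens : M → X → ℝ)
    (g : Metric n M) (conn : Conn n M) : Prop where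
  smooth : CovariantDerivative.ContMDiffCovariantDerivative conn ∞
  metric_eq : ∀ V W : ∀ p : M, TangentSpace (𝓡 n) p, IsSmoothVF V → IsSmoothVF W →
    ∀ p, g.inner p (V p) (W p) = gForm μ h τ dens V W p
  conn_eq : ∀ Z V W : ∀ p : M, TangentSpace (𝓡 n) p,
    IsSmoothVF Z → IsSmoothVF V → IsSmoothVF W →
    ∀ p, g.inner p (conn V p (Z p)) (W p) = connForm μ h τ dens Z V W p

/-- Differentiation and integration commute for `𝕀_τ`:
`V_p(𝕀_τ) = ∫ V_p(τ ∘ e_x) dμ(x)` for every smooth vector field `V` and every `p ∈ M`. -/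
def MeanTauExchange (n : ℕ) {M : Type*} [TopologicalSpace M]
    [ChartedSpace (EuclideanSpace ℝ (Fin n)) M] [IsManifold (𝓡 n) ∞ M] (μ : Measure X) (τ : ℝ → ℝ)
    (dens : M → X → ℝ) : Prop :=
  ∀ V : ∀ p : M, TangentSpace (𝓡 n) p, IsSmoothVF V → ∀ p : M,
    dir V (meanFun μ dens τ) p = ∫ x, dir V (fun q => τ (dens q x)) p ∂μ

end DeformedExp

end

open DeformedExp

/-! Write `λ` for the constant, so that `τ ℓ' = λ` on `I`. This has two consequences. The function
`h∘τ - τℓ + λ·id` has zero derivative, so `d(t,s) = τ(t)(ℓ(t) - ℓ(s)) - λ(t - s)` (`dFun_eq`). And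
`τ(e_x) · V(ℓ∘e_x) = λ · V e_x`, which turns derivatives of `ℓ∘e_x`, weighted by `τ`, into
derivatives of densities, whose integrals vanish.

In a global representation `ℓ∘e_x = ⟨θ, T(x)⟩ - c(x) - ψ`. Let `D` be the flat connection of the
coordinates `θ`. Then `V(W(ℓ∘e_x)) = (D_V W)(ℓ∘e_x) - Hess ψ(V,W)`, where the last term is free of
`x`. Differentiating `τ(e_x) W(ℓ∘e_x) = λ W e_x` once more (`lam_mul_mvfderiv_dir_dens`) and
integrating gives `g^{h,τ} = 𝕀_τ · Hess ψ` (`integrable_tau_mul_coordHess`). `Hess ψ(v,v) ≠ 0` for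
`v ≠ 0` by continuity of `T` and full support of `μ`; dividing by it makes `𝕀_τ` finite and smooth.

In the same way `g^{h,τ}(∇_Z V, W) = 𝕀_τ Hess ψ(D_Z V, W) - Hess ψ(Z,V) · W(𝕀_τ)` (`connForm_eq`).
The 1-conformal change with factor `1/𝕀_τ` removes exactly the last term, so the new pair is `(Hess
ψ, D)`, which is Hessian with potential `ψ`. Integrating the closed form of `d` gives `𝕀_τ(p)` times
the Bregman divergence of `ψ` in the coordinates `θ` (`integral_dFun`), which is the canonical
divergence; other affine charts and potentials differ from `θ`, `ψ` by affine terms, which do not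
affect it.

Global representations come from gluing (`exists_global_rep`): two densities whose `ℓ`-values differ
by a constant coincide, which makes `T` affinely independent and local representations affinely
related. -/

noncomputable section
set_option linter.unusedSectionVars false

namespace DeformedExp

/-! ### Calculus of `τ`, `ℓ` and `d` on the interval `I` -/

namespace IsAdmissible

variable {h τ : ℝ → ℝ} {I : Set ℝ} (hadm : IsAdmissible h τ I)
include hadm

theorem hasDerivAt_tau {t : ℝ} (ht : t ∈ I) : HasDerivAt τ (deriv τ t) t :=
  ((hadm.smooth_tau.differentiableOn (by simp)).differentiableAt
    (hadm.isOpen.mem_nhds ht)).hasDerivAt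

/-- A nonvanishing strict derivative makes `τ` locally open. Openness is what lets `deriv h` and its
smoothness on `τ '' I` be used without one-sided derivatives. -/
theorem isOpen_image : IsOpen (τ '' I) := by
  rw [isOpen_iff_mem_nhds]
  rintro _ ⟨t, ht, rfl⟩
  have h1 : ContDiffAt ℝ ∞ τ t := hadm.smooth_tau.contDiffAt (hadm.isOpen.mem_nhds ht)
  have h2 : HasStrictDerivAt τ (deriv τ t) t := h1.hasStrictDerivAt (by simp)
  rw [← h2.map_nhds_eq (hadm.deriv_tau_pos t ht).ne']
  exact Filter.image_mem_map (hadm.isOpen.mem_nhds ht)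

theorem contDiffOn_deriv_h : ContDiffOn ℝ ∞ (deriv h) (τ '' I) :=
  ((contDiffOn_infty_iff_deriv_of_isOpen hadm.isOpen_image).1 hadm.smooth_h).2

theorem contDiffOn_ellFun : ContDiffOn ℝ ∞ (ellFun h τ) I :=
  hadm.contDiffOn_deriv_h.comp hadm.smooth_tau (mapsTo_image τ I)

theorem hasDerivAt_ellFun {t : ℝ} (ht : t ∈ I) :
    HasDerivAt (ellFun h τ) (deriv (ellFun h τ) t) t :=
  ((hadm.contDiffOn_ellFun.differentiableOn (by simp)).differentiableAt
    (hadm.isOpen.mem_nhds ht)).hasDerivAt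

theorem hasDerivAt_h {t : ℝ} (ht : t ∈ I) : HasDerivAt h (ellFun h τ t) (τ t) :=
  ((hadm.smooth_h.differentiableOn (by simp)).differentiableAt
    (hadm.isOpen_image.mem_nhds (mem_image_of_mem τ ht))).hasDerivAt

theorem deriv_ellFun_pos {t : ℝ} (ht : t ∈ I) : 0 < deriv (ellFun h τ) t := by
  have h1 : HasDerivAt (deriv h) (deriv (deriv h) (τ t)) (τ t) :=
    ((hadm.contDiffOn_deriv_h.differentiableOn (by simp)).differentiableAt
    (hadm.isOpen_image.mem_nhds (mem_image_of_mem τ ht))).hasDerivAt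
  have h2 : HasDerivAt (ellFun h τ) _ t := h1.comp t (hadm.hasDerivAt_tau ht)
  rw [h2.deriv]
  exact mul_pos (hadm.deriv_deriv_h_pos _ (mem_image_of_mem τ ht)) (hadm.deriv_tau_pos t ht)

theorem strictMonoOn_ellFun : StrictMonoOn (ellFun h τ) I := by
  refine strictMonoOn_of_deriv_pos hadm.ordConnected.convex hadm.contDiffOn_ellFun.continuousOn ?_
  intro t ht
  exact hadm.deriv_ellFun_pos (interior_subset ht)

/-- The derivative in `t` is `τ'(t)(ℓ(t) - ℓ(s))`, which has the sign of `t - s`; the mean value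
theorem then compares with the value `0` at `t = s`. -/
theorem dFun_pos {t s : ℝ} (ht : t ∈ I) (hs : s ∈ I) (hts : t ≠ s) : 0 < dFun h τ t s := by
  have hd : ∀ r ∈ I, HasDerivAt (fun t => dFun h τ t s)
      (deriv τ r * (ellFun h τ r - ellFun h τ s)) r := by
    intro r hr
    have h1 := ((hadm.hasDerivAt_h hr).comp r (hadm.hasDerivAt_tau hr)).sub_const (h (τ s))
    have h2 := ((hadm.hasDerivAt_tau hr).sub_const (τ s)).mul_const (deriv h (τ s))
    refine (h1.sub h2).congr_deriv ?_
    simp only [ellFun]; ring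
  have hss : dFun h τ s s = 0 := by simp [dFun]
  have hcont : ∀ a ∈ I, ∀ b ∈ I, ContinuousOn (fun t => dFun h τ t s) (Icc a b) :=
    fun a ha b hb r hr =>
      (hd r (hadm.ordConnected.out ha hb hr)).continuousAt.continuousWithinAt
  rcases lt_or_gt_of_ne hts with hlt | hlt
  · obtain ⟨r, hr, hr'⟩ := exists_hasDerivAt_eq_slope (fun t => dFun h τ t s) _ hlt
      (hcont t ht s hs) (fun r hr => hd r (hadm.ordConnected.out ht hs (Ioo_subset_Icc_self hr)))
    have hrI := hadm.ordConnected.out ht hs (Ioo_subset_Icc_self hr)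
    rw [hss, zero_sub, eq_div_iff (sub_pos.2 hlt).ne'] at hr'
    have h3 := hadm.deriv_tau_pos r hrI
    have h4 := hadm.strictMonoOn_ellFun hrI hs hr.2
    have h5 := mul_pos (mul_pos h3 (sub_pos.2 h4)) (sub_pos.2 hlt)
    linarith
  · obtain ⟨r, hr, hr'⟩ := exists_hasDerivAt_eq_slope (fun t => dFun h τ t s) _ hlt
      (hcont s hs t ht) (fun r hr => hd r (hadm.ordConnected.out hs ht (Ioo_subset_Icc_self hr)))
    have hrI := hadm.ordConnected.out hs ht (Ioo_subset_Icc_self hr)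
    rw [hss, sub_zero, eq_div_iff (sub_pos.2 hlt).ne'] at hr'
    have h3 := hadm.deriv_tau_pos r hrI
    have h4 := hadm.strictMonoOn_ellFun hs hrI hr.1
    have h5 := mul_pos (mul_pos h3 (sub_pos.2 h4)) (sub_pos.2 hlt)
    linarith

theorem dFun_nonneg {t s : ℝ} (ht : t ∈ I) (hs : s ∈ I) : 0 ≤ dFun h τ t s := by
  rcases eq_or_ne t s with rfl | hts
  · simp [dFun]
  · exact (hadm.dFun_pos ht hs hts).le

variable {lam : ℝ} (hlam : ∀ t ∈ I, τ t / chiFun h τ t = lam)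
include hlam

theorem tau_mul_deriv_ellFun {t : ℝ} (ht : t ∈ I) : τ t * deriv (ellFun h τ) t = lam := by
  have := hlam t ht
  rwa [chiFun, div_div_eq_mul_div, div_one] at this

theorem tau_pos (hlam0 : 0 < lam) {t : ℝ} (ht : t ∈ I) : 0 < τ t := by
  have h1 := hadm.tau_mul_deriv_ellFun hlam ht
  have h2 := hadm.deriv_ellFun_pos ht
  by_contra! h3
  nlinarith

/-- The function `h∘τ - τℓ + λ·id` has derivative `-τℓ' + λ = 0`, so `h` can be eliminated from `d`.
What remains is affine in `ℓ(s)` and `s`, hence suited to exponential coordinates. -/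
theorem dFun_eq {t s : ℝ} (ht : t ∈ I) (hs : s ∈ I) :
    dFun h τ t s = τ t * (ellFun h τ t - ellFun h τ s) - lam * (t - s) := by
  have hd : ∀ r ∈ I, HasDerivAt (fun t => h (τ t) - τ t * ellFun h τ t + lam * t) 0 r := by
    intro r hr
    have h1 := (hadm.hasDerivAt_h hr).comp r (hadm.hasDerivAt_tau hr)
    have h2 := (hadm.hasDerivAt_tau hr).mul (hadm.hasDerivAt_ellFun hr)
    refine ((h1.sub h2).add ((hasDerivAt_id r).const_mul lam)).congr_deriv ?_
    have := hadm.tau_mul_deriv_ellFun hlam hr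
    linear_combination -this
  have hc := hadm.isOpen.is_const_of_deriv_eq_zero hadm.ordConnected.isPreconnected
    (fun r hr => (hd r hr).differentiableAt.differentiableWithinAt)
    (fun r hr => (hd r hr).deriv) ht hs
  simp only [dFun]
  simp only [ellFun] at hc ⊢
  linear_combination hc

end IsAdmissible

/-! ### Derivatives read in a chart -/

section Charts

variable {n : ℕ} {M : Type*} [TopologicalSpace M] [ChartedSpace (EuclideanSpace ℝ (Fin n)) M]
  {F F' : Type*} [NormedAddCommGroup F] [NormedSpace ℝ F] [NormedAddCommGroup F']
  [NormedSpace ℝ F']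

theorem mvfderiv_comp_fderiv {f : M → F} {G : F → F'} {p : M} (hG : DifferentiableAt ℝ G (f p))
    (hf : MDifferentiableAt (𝓡 n) 𝓘(ℝ, F) f p) (v : TangentSpace (𝓡 n) p) :
    mvfderiv (𝓡 n) (fun q => G (f q)) p v = fderiv ℝ G (f p) (mvfderiv (𝓡 n) f p v) := by
  have h1 := (hG.hasFDerivAt.hasMFDerivAt.comp p hf.hasMFDerivAt).mfderiv
  change mfderiv (𝓡 n) 𝓘(ℝ, F') (G ∘ f) p v = _
  rw [h1]; rfl

theorem mvfderiv_congr {f g : M → F} {p : M} (hfg : f =ᶠ[nhds p] g) :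
    mvfderiv (𝓡 n) f p = mvfderiv (𝓡 n) g p := by
  have h := hfg.mfderiv_eq (I := 𝓡 n) (I' := 𝓘(ℝ, F))
  ext v
  exact congrArg (fun L : TangentSpace (𝓡 n) p →L[ℝ] F => L v) h

theorem mvfderiv_clm_apply {c : M → F →L[ℝ] F'} {u : M → F} {p : M}
    (hc : MDifferentiableAt (𝓡 n) 𝓘(ℝ, F →L[ℝ] F') c p)
    (hu : MDifferentiableAt (𝓡 n) 𝓘(ℝ, F) u p) (v : TangentSpace (𝓡 n) p) :
    mvfderiv (𝓡 n) (fun q => c q (u q)) p v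
      = mvfderiv (𝓡 n) c p v (u p) + c p (mvfderiv (𝓡 n) u p v) := by
  have h1 := (hc.prodMk_space hu)
  have h2 : DifferentiableAt ℝ (fun z : (F →L[ℝ] F') × F => z.1 z.2) (c p, u p) :=
    differentiableAt_fst.clm_apply differentiableAt_snd
  have h3 := mvfderiv_comp_fderiv (f := fun q => (c q, u q)) (p := p) h2 h1 v
  rw [h3]
  have h4 : mvfderiv (𝓡 n) (fun q => (c q, u q)) p v
      = (mvfderiv (𝓡 n) c p v, mvfderiv (𝓡 n) u p v) := by
    refine Prod.ext ?_ ?_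
    · have := mvfderiv_comp_fderiv (f := fun q => (c q, u q)) (G := Prod.fst) (p := p)
        differentiableAt_fst h1 v
      simpa [fderiv_fst] using this.symm
    · have := mvfderiv_comp_fderiv (f := fun q => (c q, u q)) (G := Prod.snd) (p := p)
        differentiableAt_snd h1 v
      simpa [fderiv_snd] using this.symm
  rw [h4]
  rw [fderiv_clm_apply differentiableAt_fst differentiableAt_snd]
  simp [fderiv_fst, fderiv_snd, add_comm]

variable {θ : OpenPartialHomeomorph M (EuclideanSpace ℝ (Fin n))}
  (hθ : θ ∈ IsManifold.maximalAtlas (𝓡 n) ∞ M)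
include hθ

theorem mdifferentiableAt_chart {p : M} (hp : p ∈ θ.source) :
    MDifferentiableAt (𝓡 n) (𝓡 n) θ p :=
  (contMDiffAt_of_mem_maximalAtlas hθ hp).mdifferentiableAt (by simp)

theorem isInvertible_mvfderiv_chart {p : M} (hp : p ∈ θ.source) :
    (mvfderiv (𝓡 n) θ p).IsInvertible := by
  have h1 : θ.MDifferentiable (𝓡 n) (𝓡 n) :=
    ⟨(contMDiffOn_of_mem_maximalAtlas hθ).mdifferentiableOn (by simp),
      (contMDiffOn_symm_of_mem_maximalAtlas hθ).mdifferentiableOn (by simp)⟩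
  exact ⟨h1.mfderiv hp, rfl⟩

theorem mvfderiv_chart_inverse {p : M} (hp : p ∈ θ.source) (w : EuclideanSpace ℝ (Fin n)) :
    mvfderiv (𝓡 n) θ p ((mvfderiv (𝓡 n) θ p).inverse w) = w :=
  (isInvertible_mvfderiv_chart hθ hp).self_apply_inverse w

theorem inverse_mvfderiv_chart {p : M} (hp : p ∈ θ.source) (v : TangentSpace (𝓡 n) p) :
    (mvfderiv (𝓡 n) θ p).inverse (mvfderiv (𝓡 n) θ p v) = v :=
  (isInvertible_mvfderiv_chart hθ hp).inverse_apply_self v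

theorem mdifferentiableAt_comp_symm {f : M → F} {p : M} (hp : p ∈ θ.source)
    (hf : MDifferentiableAt (𝓡 n) 𝓘(ℝ, F) f p) :
    DifferentiableAt ℝ (fun y => f (θ.symm y)) (θ p) := by
  have h1 : MDifferentiableAt (𝓡 n) (𝓡 n) θ.symm (θ p) :=
    (contMDiffAt_symm_of_mem_maximalAtlas hθ (θ.map_source hp)).mdifferentiableAt (by simp)
  rw [← θ.left_inv hp] at hf
  exact (hf.comp (θ p) h1).differentiableAt

theorem mvfderiv_eq_fderiv_symm {f : M → F} {p : M} (hp : p ∈ θ.source)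
    (hf : MDifferentiableAt (𝓡 n) 𝓘(ℝ, F) f p) (v : TangentSpace (𝓡 n) p) :
    mvfderiv (𝓡 n) f p v
      = fderiv ℝ (fun y => f (θ.symm y)) (θ p) (mvfderiv (𝓡 n) θ p v) := by
  rw [← mvfderiv_comp_fderiv (mdifferentiableAt_comp_symm hθ hp hf)
    (mdifferentiableAt_chart hθ hp) v]
  rw [mvfderiv_congr (g := fun q => f (θ.symm (θ q)))]
  filter_upwards [θ.open_source.mem_nhds hp] with q hq
  rw [θ.left_inv hq]

theorem contDiffOn_comp_symm {f : M → F} (hf : ContMDiffOn (𝓡 n) 𝓘(ℝ, F) ∞ f θ.source) :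
    ContDiffOn ℝ ∞ (fun y => f (θ.symm y)) θ.target :=
  (hf.comp (contMDiffOn_symm_of_mem_maximalAtlas hθ) θ.mapsTo_symm).contDiffOn

end Charts

theorem two_le_infty : (2 : WithTop ℕ∞) ≤ ∞ := 
  WithTop.coe_le_coe.2 (le_top : (2 : ℕ∞) ≤ ⊤)

/-! ### The flat connection and the Hessian of a global chart -/

section GlobalChart

variable {n : ℕ} {M : Type*} [TopologicalSpace M] [ChartedSpace (EuclideanSpace ℝ (Fin n)) M]
  [IsManifold (𝓡 n) ∞ M] {F : Type*} [NormedAddCommGroup F] [NormedSpace ℝ F]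

/-- The flat connection for which the coordinate vector fields of `θ` are parallel. -/
def flatDeriv (θ : OpenPartialHomeomorph M (EuclideanSpace ℝ (Fin n)))
    (W : ∀ p : M, TangentSpace (𝓡 n) p) (p : M) :
    TangentSpace (𝓡 n) p →L[ℝ] TangentSpace (𝓡 n) p :=
  (mvfderiv (𝓡 n) θ p).inverse ∘L mvfderiv (𝓡 n) (fun q => mvfderiv (𝓡 n) θ q (W q)) p

/-- The Hessian of `f` in the coordinates `θ`. -/
def coordHess (θ : OpenPartialHomeomorph M (EuclideanSpace ℝ (Fin n))) (f : M → F) (p : M) :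
    TangentSpace (𝓡 n) p →L[ℝ] TangentSpace (𝓡 n) p →L[ℝ] F :=
  ContinuousLinearMap.precomp F (mvfderiv (𝓡 n) θ p) ∘L
    fderiv ℝ (fderiv ℝ (fun y => f (θ.symm y))) (θ p) ∘L mvfderiv (𝓡 n) θ p

/-- The function `w` on `M`, read in the chart `θ` as a vector field on the model space. -/
def modelVF (θ : OpenPartialHomeomorph M (EuclideanSpace ℝ (Fin n)))
    (w : M → EuclideanSpace ℝ (Fin n)) :
    ∀ y : EuclideanSpace ℝ (Fin n), TangentSpace (𝓡 n) y :=
  fun y => w (θ.symm y)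

variable {θ : OpenPartialHomeomorph M (EuclideanSpace ℝ (Fin n))}

omit [IsManifold (𝓡 n) ∞ M] in
theorem coordHess_apply (f : M → F) (p : M) (v w : TangentSpace (𝓡 n) p) :
    coordHess θ f p v w = fderiv ℝ (fderiv ℝ (fun y => f (θ.symm y))) (θ p)
      (mvfderiv (𝓡 n) θ p v) (mvfderiv (𝓡 n) θ p w) := rfl

omit [IsManifold (𝓡 n) ∞ M] in
theorem mpullback_modelVF (hs : θ.source = univ) (w : M → EuclideanSpace ℝ (Fin n)) (q : M) :
    VectorField.mpullback (𝓡 n) (𝓡 n) θ (modelVF θ w) q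
      = (mvfderiv (𝓡 n) θ q).inverse (w q) := by
  rw [VectorField.mpullback_apply]
  exact congrArg (fun q' => (mvfderiv (𝓡 n) θ q).inverse (w q'))
    (θ.left_inv (show q ∈ θ.source by simp [hs]))

variable (hθ : θ ∈ IsManifold.maximalAtlas (𝓡 n) ∞ M) (hs : θ.source = univ)
include hθ hs

omit [IsManifold (𝓡 n) ∞ M] in
theorem contMDiff_chart : ContMDiff (𝓡 n) (𝓡 n) ∞ θ := by
  have := contMDiffOn_of_mem_maximalAtlas hθ
  rwa [hs, contMDiffOn_univ] at this

theorem contMDiff_coord {V : ∀ p : M, TangentSpace (𝓡 n) p} (hV : IsSmoothVF V) :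
    ContMDiff (𝓡 n) 𝓘(ℝ, EuclideanSpace ℝ (Fin n)) ∞ (fun q => mvfderiv (𝓡 n) θ q (V q)) := by
  have h1 := (contMDiff_chart hθ hs).contMDiff_tangentMap (m := ∞) (by simp)
  have h2 := (contMDiff_snd_tangentBundle_modelSpace (n := ∞) (EuclideanSpace ℝ (Fin n)) (𝓡 n)).comp
    (h1.comp hV)
  exact h2

theorem mdifferentiableAt_coord {V : ∀ p : M, TangentSpace (𝓡 n) p} {p : M}
    (hV : MDifferentiableAt (𝓡 n) (𝓡 n).tangent
      (fun p => (⟨p, V p⟩ : TangentBundle (𝓡 n) M)) p) :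
    MDifferentiableAt (𝓡 n) 𝓘(ℝ, EuclideanSpace ℝ (Fin n))
      (fun q => mvfderiv (𝓡 n) θ q (V q)) p := by
  have h1 := (contMDiff_chart hθ hs).contMDiff_tangentMap (m := ∞) (by simp)
  have h2 := (contMDiff_snd_tangentBundle_modelSpace (n := ∞) (EuclideanSpace ℝ (Fin n)) (𝓡 n)).comp
    h1
  exact ((h2.mdifferentiable (by simp)) _).comp p hV

omit [IsManifold (𝓡 n) ∞ M] in
theorem contDiffAt_comp_symm {f : M → F} (hf : ContMDiff (𝓡 n) 𝓘(ℝ, F) ∞ f) (p : M) :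
    ContDiffAt ℝ ∞ (fun y => f (θ.symm y)) (θ p) :=
  (contDiffOn_comp_symm hθ hf.contMDiffOn).contDiffAt
    (θ.open_target.mem_nhds (θ.map_source (by simp [hs])))

/-- Such a field is the pullback under `θ` of a smooth field on the model space. With constant `w`
it extends a given tangent vector to a global smooth field without cutoff functions. -/
theorem isSmoothVF_inverse {w : M → EuclideanSpace ℝ (Fin n)}
    (hw : ContMDiff (𝓡 n) 𝓘(ℝ, EuclideanSpace ℝ (Fin n)) ∞ w) :
    IsSmoothVF (fun p => (mvfderiv (𝓡 n) θ p).inverse (w p)) := by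
  intro p
  have h1 := contDiffAt_comp_symm hθ hs hw p
  have h2 := (contMDiffAt_vectorSpace_iff_contDiffAt (n := ∞)
    (V := modelVF θ w) (x := θ p)).2 h1
  have h3 := ContMDiffAt.mpullback_vectorField_preimage (I := 𝓡 n) (I' := 𝓡 n) (f := θ)
    (x₀ := p) h2 (contMDiff_chart hθ hs p)
    (isInvertible_mvfderiv_chart hθ (by simp [hs])) (by simp)
  refine h3.congr_of_eventuallyEq (Filter.Eventually.of_forall fun q => ?_)
  exact congrArg (fun v => (⟨q, v⟩ : TangentBundle (𝓡 n) M)) (mpullback_modelVF hs w q).symm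

theorem contMDiff_mvfderiv_apply {f : M → F} (hf : ContMDiff (𝓡 n) 𝓘(ℝ, F) ∞ f)
    {V : ∀ p : M, TangentSpace (𝓡 n) p} (hV : IsSmoothVF V) :
    ContMDiff (𝓡 n) 𝓘(ℝ, F) ∞ (fun q => mvfderiv (𝓡 n) f q (V q)) := by
  intro p
  have h1 := (contDiffAt_comp_symm hθ hs hf p).fderiv_right (m := ∞) (by simp)
  have h2 := (h1.contMDiffAt.comp p (contMDiff_chart hθ hs p)).clm_apply
    (contMDiff_coord hθ hs hV p)
  refine h2.congr_of_eventuallyEq (Filter.Eventually.of_forall fun q => ?_)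
  exact mvfderiv_eq_fderiv_symm hθ (by simp [hs]) (hf.mdifferentiableAt (by simp)) _

theorem isSmoothVF_flatDeriv {V W : ∀ p : M, TangentSpace (𝓡 n) p} (hV : IsSmoothVF V)
    (hW : IsSmoothVF W) : IsSmoothVF (fun p => flatDeriv θ W p (V p)) :=
  isSmoothVF_inverse hθ hs (contMDiff_mvfderiv_apply hθ hs (contMDiff_coord hθ hs hW) hV)

omit [IsManifold (𝓡 n) ∞ M] in
theorem mvfderiv_chart_flatDeriv (W : ∀ p : M, TangentSpace (𝓡 n) p) (p : M)
    (v : TangentSpace (𝓡 n) p) : mvfderiv (𝓡 n) θ p (flatDeriv θ W p v)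
      = mvfderiv (𝓡 n) (fun q => mvfderiv (𝓡 n) θ q (W q)) p v :=
  mvfderiv_chart_inverse hθ (by simp [hs]) _

/-- Product rule for the coordinate derivative of `f` applied to the coordinates of `W`: the part
tensorial in `W` is split from the part that differentiates `W`. Vector values `F` are needed for
the curvature, where `f` is the coordinate expression of a field. -/
theorem mvfderiv_mvfderiv {f : M → F} (hf : ContMDiff (𝓡 n) 𝓘(ℝ, F) ∞ f)
    {W : ∀ p : M, TangentSpace (𝓡 n) p} (hW : IsSmoothVF W) (p : M) (v : TangentSpace (𝓡 n) p) :
    mvfderiv (𝓡 n) (fun q => mvfderiv (𝓡 n) f q (W q)) p v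
      = coordHess θ f p v (W p) + mvfderiv (𝓡 n) f p (flatDeriv θ W p v) := by
  have hfd : ∀ q, MDifferentiableAt (𝓡 n) 𝓘(ℝ, F) f q := fun q => hf.mdifferentiableAt (by simp)
  have hd : DifferentiableAt ℝ (fderiv ℝ (fun y => f (θ.symm y))) (θ p) :=
    ((contDiffAt_comp_symm hθ hs hf p).fderiv_right (m := ∞) (by simp)).differentiableAt (by simp)
  have h1 : (fun q => mvfderiv (𝓡 n) f q (W q))
      = fun q => fderiv ℝ (fun y => f (θ.symm y)) (θ q) (mvfderiv (𝓡 n) θ q (W q)) :=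
    funext fun q => mvfderiv_eq_fderiv_symm hθ (by simp [hs]) (hfd q) _
  have hθd := mdifferentiableAt_chart hθ (p := p) (by simp [hs])
  rw [h1, mvfderiv_clm_apply (c := fun q => fderiv ℝ (fun y => f (θ.symm y)) (θ q))
    (hd.mdifferentiableAt.comp p hθd) ((contMDiff_coord hθ hs hW).mdifferentiableAt (by simp)),
    mvfderiv_comp_fderiv hd hθd, coordHess_apply,
    mvfderiv_eq_fderiv_symm hθ (by simp [hs]) (hfd p), mvfderiv_chart_flatDeriv hθ hs]

omit [IsManifold (𝓡 n) ∞ M] in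
theorem coordHess_symm {f : M → F} (hf : ContMDiff (𝓡 n) 𝓘(ℝ, F) ∞ f) (p : M)
    (v w : TangentSpace (𝓡 n) p) : coordHess θ f p v w = coordHess θ f p w v := by
  have h1 : IsSymmSndFDerivAt ℝ (fun y => f (θ.symm y)) (θ p) :=
    (contDiffAt_comp_symm hθ hs hf p).isSymmSndFDerivAt (by simp [two_le_infty])
  rw [coordHess_apply, coordHess_apply]
  exact h1 _ _

/-- Brackets commute with the pullback along `θ`, and on the model space the bracket is the
antisymmetrised derivative. This is the vanishing of the torsion of `flatDeriv`. -/
theorem mlieBracket_eq_flatDeriv {V W : ∀ p : M, TangentSpace (𝓡 n) p} (hV : IsSmoothVF V)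
    (hW : IsSmoothVF W) (p : M) : VectorField.mlieBracket (𝓡 n) V W p
      = flatDeriv θ W p (V p) - flatDeriv θ V p (W p) := by
  have key : ∀ U : ∀ p : M, TangentSpace (𝓡 n) p,
      VectorField.mpullback (𝓡 n) (𝓡 n) θ (modelVF θ fun q => mvfderiv (𝓡 n) θ q (U q)) = U :=
    fun U => funext fun q => (mpullback_modelVF hs _ q).trans
      (inverse_mvfderiv_chart hθ (by simp [hs]) _)
  have hm : ∀ U : ∀ p : M, TangentSpace (𝓡 n) p, IsSmoothVF U →
      MDifferentiableAt (𝓡 n) (𝓡 n).tangent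
        (fun y => (⟨y, modelVF θ (fun q => mvfderiv (𝓡 n) θ q (U q)) y⟩ :
          TangentBundle (𝓡 n) (EuclideanSpace ℝ (Fin n)))) (θ p) := fun U hU =>
    ((contMDiffAt_vectorSpace_iff_contDiffAt (n := ∞)
      (V := modelVF θ (fun q => mvfderiv (𝓡 n) θ q (U q))) (x := θ p)).2
        (contDiffAt_comp_symm hθ hs (contMDiff_coord hθ hs hU) p)).mdifferentiableAt (by simp)
  have : IsManifold (𝓡 n) (minSmoothness ℝ 2) M :=
    IsManifold.of_le (n := ∞) (by simp [two_le_infty])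
  have h1 := VectorField.mpullback_mlieBracket (n := ∞) (hm V hV) (hm W hW)
    (contMDiff_chart hθ hs p) (by simp [two_le_infty])
  rw [key V, key W, VectorField.mpullback_apply] at h1
  have e : ∀ U U' : ∀ p : M, TangentSpace (𝓡 n) p, IsSmoothVF U →
      fderiv ℝ (fun y => mvfderiv (𝓡 n) θ (θ.symm y) (U (θ.symm y))) (θ p)
        (mvfderiv (𝓡 n) θ (θ.symm (θ p)) (U' (θ.symm (θ p))))
      = mvfderiv (𝓡 n) (fun q => mvfderiv (𝓡 n) θ q (U q)) p (U' p) := by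
    intro U U' hU
    rw [mvfderiv_eq_fderiv_symm hθ (p := p) (by simp [hs])
      ((contMDiff_coord hθ hs hU).mdifferentiableAt (by simp)),
      θ.left_inv (show p ∈ θ.source by simp [hs])]
  have h2 : VectorField.mlieBracket (𝓡 n) (modelVF θ fun q => mvfderiv (𝓡 n) θ q (V q))
      (modelVF θ fun q => mvfderiv (𝓡 n) θ q (W q)) (θ p)
      = mvfderiv (𝓡 n) (fun q => mvfderiv (𝓡 n) θ q (W q)) p (V p)
        - mvfderiv (𝓡 n) (fun q => mvfderiv (𝓡 n) θ q (V q)) p (W p) := by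
    rw [← e W V hW, ← e V W hV, ← VectorField.mlieBracketWithin_univ,
      VectorField.mlieBracketWithin_eq_lieBracketWithin]
    exact congrFun (VectorField.lieBracketWithin_univ (𝕜 := ℝ)
      (V := fun y => mvfderiv (𝓡 n) θ (θ.symm y) (V (θ.symm y)))
      (W := fun y => mvfderiv (𝓡 n) θ (θ.symm y) (W (θ.symm y)))) (θ p)
  rw [← h1, h2]
  exact map_sub (mvfderiv (𝓡 n) θ p).inverse _ _

end GlobalChart

/-! ### Smoothness of bundle homomorphisms, tested on coordinate fields -/

section HomBundle

variable {n : ℕ} {M : Type*} [TopologicalSpace M] [ChartedSpace (EuclideanSpace ℝ (Fin n)) M]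
  {F : Type*} [NormedAddCommGroup F] [NormedSpace ℝ F]

theorem sum_single_eq (v : EuclideanSpace ℝ (Fin n)) :
    v = ∑ i, v i • EuclideanSpace.single i (1 : ℝ) := by
  ext j
  simp [Pi.single_apply]

theorem contMDiffAt_clm_of_apply {f : M → EuclideanSpace ℝ (Fin n) →L[ℝ] F} {p : M}
    (hf : ∀ i, ContMDiffAt (𝓡 n) 𝓘(ℝ, F) ∞ (fun q => f q (EuclideanSpace.single i 1)) p) :
    ContMDiffAt (𝓡 n) 𝓘(ℝ, EuclideanSpace ℝ (Fin n) →L[ℝ] F) ∞ f p := by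
  have h1 : f = fun q => ∑ i, ContinuousLinearMap.smulRightL ℝ (EuclideanSpace ℝ (Fin n)) F
      (EuclideanSpace.proj i) (f q (EuclideanSpace.single i 1)) := by
    funext q
    ext v
    conv_lhs => rw [sum_single_eq v]
    simp
  rw [h1]
  refine contMDiffAt_finsetSum fun i _ => ?_
  exact (ContinuousLinearMap.contMDiff _).contMDiffAt.comp p (hf i)

variable [IsManifold (𝓡 n) ∞ M]
  {V : M → Type*} [TopologicalSpace (Bundle.TotalSpace F V)]
  [∀ x, AddCommGroup (V x)] [∀ x, Module ℝ (V x)] [∀ x : M, TopologicalSpace (V x)]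
  [∀ x, IsTopologicalAddGroup (V x)] [∀ x, ContinuousSMul ℝ (V x)]
  [FiberBundle F V] [VectorBundle ℝ F V]
  {θ : OpenPartialHomeomorph M (EuclideanSpace ℝ (Fin n))}
  (hθ : θ ∈ IsManifold.maximalAtlas (𝓡 n) ∞ M) (hs : θ.source = univ)
include hθ hs

theorem contMDiffAt_coord {U : ∀ p : M, TangentSpace (𝓡 n) p} {p : M}
    (hU : ContMDiffAt (𝓡 n) (𝓡 n).tangent ∞
      (fun p => (⟨p, U p⟩ : TangentBundle (𝓡 n) M)) p) :
    ContMDiffAt (𝓡 n) 𝓘(ℝ, EuclideanSpace ℝ (Fin n)) ∞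
      (fun q => mvfderiv (𝓡 n) θ q (U q)) p := by
  have h1 := (contMDiff_chart hθ hs).contMDiff_tangentMap (m := ∞) (by simp)
  have h2 := (contMDiff_snd_tangentBundle_modelSpace (n := ∞) (EuclideanSpace ℝ (Fin n)) (𝓡 n)).comp
    h1
  exact (h2.contMDiffAt).comp p hU

omit [IsManifold (𝓡 n) ∞ M] in
theorem eq_sum_frame (p : M) (v : TangentSpace (𝓡 n) p) :
    v = ∑ i, mvfderiv (𝓡 n) θ p v i • coordVF θ i p := by
  conv_lhs => rw [← inverse_mvfderiv_chart hθ (p := p) (by simp [hs]) v,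
    sum_single_eq (mvfderiv (𝓡 n) θ p v), map_sum]
  simp only [map_smul, coordVF]

theorem isSmoothVF_coordVF (i : Fin n) : IsSmoothVF (M := M) (coordVF θ i) :=
  isSmoothVF_inverse hθ hs contMDiff_const

/-- A homomorphism from the tangent bundle to a smooth vector bundle is smooth as soon as it maps
the coordinate vector fields to smooth sections. -/
theorem contMDiff_hom_of_coordVF (φ : ∀ p : M, TangentSpace (𝓡 n) p →L[ℝ] V p)
    (hφ : ∀ i, ContMDiff (𝓡 n) ((𝓡 n).prod 𝓘(ℝ, F)) ∞
      (fun p => Bundle.TotalSpace.mk' F p (φ p (coordVF θ i p)))) :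
    ContMDiff (𝓡 n) ((𝓡 n).prod 𝓘(ℝ, EuclideanSpace ℝ (Fin n) →L[ℝ] F)) ∞
      (fun p => Bundle.TotalSpace.mk' (EuclideanSpace ℝ (Fin n) →L[ℝ] F)
        (E := fun p : M => TangentSpace (𝓡 n) p →L[ℝ] V p) p (φ p)) := by
  intro p₀
  rw [contMDiffAt_hom_bundle]
  refine ⟨contMDiffAt_id, contMDiffAt_clm_of_apply fun i => ?_⟩
  set e := trivializationAt (EuclideanSpace ℝ (Fin n)) (TangentSpace (𝓡 n) : M → Type _) p₀
  have hp₀ : p₀ ∈ e.baseSet := FiberBundle.mem_baseSet_trivializationAt' p₀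
  -- The local frame field of the trivialization has constant coordinates there, so it is smooth;
  -- expanding it in the global frame of `θ` with smooth coefficients reduces the claim to `hφ`.
  have h1 : ContMDiffAt (𝓡 n) (𝓡 n).tangent ∞ (fun b => (⟨b, e.symm b
      (EuclideanSpace.single i (1 : ℝ))⟩ : TangentBundle (𝓡 n) M)) p₀ := by
    rw [e.contMDiffAt_section_iff hp₀]
    refine contMDiffAt_const (c := EuclideanSpace.single i (1 : ℝ)) |>.congr_of_eventuallyEq ?_
    filter_upwards [e.open_baseSet.mem_nhds hp₀] with b hb
    rw [e.apply_mk_symm hb]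
  have h2 := contMDiffAt_coord hθ hs h1
  have h3 : ∀ j, ContMDiffAt (𝓡 n) 𝓘(ℝ, ℝ) ∞ (fun q => mvfderiv (𝓡 n) θ q (e.symm q
      (EuclideanSpace.single i (1 : ℝ))) j) p₀ := fun j =>
    (ContinuousLinearMap.contMDiff (EuclideanSpace.proj (𝕜 := ℝ) j)).contMDiffAt.comp p₀ h2
  have h4 := ContMDiffAt.sum_section (s := Finset.univ) (fun j _ =>
    ContMDiffAt.smul_section (h3 j) (hφ j p₀))
  have h5 := (Bundle.contMDiffAt_section _).1 h4
  refine h5.congr_of_eventuallyEq ?_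
  filter_upwards [e.open_baseSet.mem_nhds hp₀,
    (trivializationAt F V p₀).open_baseSet.mem_nhds
      (FiberBundle.mem_baseSet_trivializationAt' p₀)] with b hb hb'
  simp only [ContinuousLinearMap.inCoordinates, ContinuousLinearMap.comp_apply]
  rw [Bundle.Trivialization.continuousLinearMapAt_apply, Bundle.Trivialization.coe_linearMapAt_of_mem _ hb']
  congr 3
  rw [Bundle.Trivialization.symmL_apply _ hb]
  conv_lhs => rw [eq_sum_frame hθ hs b (e.symm b _), map_sum]
  simp only [map_smul]
  rfl

end HomBundle

/-- By compactness `B u u` has a positive minimum on the unit sphere, and homogeneity turns this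
into a bound on `‖v‖`. An empty sphere only occurs for the zero space. -/
theorem isVonNBounded_of_pos {E : Type*} [NormedAddCommGroup E] [NormedSpace ℝ E]
    [FiniteDimensional ℝ E] (B : E →L[ℝ] E →L[ℝ] ℝ) (hB : ∀ v, v ≠ 0 → 0 < B v v) :
    Bornology.IsVonNBounded ℝ {v : E | B v v < 1} := by
  rw [NormedSpace.isVonNBounded_iff, isBounded_iff_forall_norm_le]
  have hcont : Continuous fun v => B v v := B.continuous.clm_apply continuous_id
  rcases (Metric.sphere (0 : E) 1).eq_empty_or_nonempty with he | hne
  · refine ⟨0, fun v _ => ?_⟩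
    by_contra! hv
    have : ‖v‖⁻¹ • v ∈ Metric.sphere (0 : E) 1 := by
      simp [norm_smul, inv_mul_cancel₀ hv.ne']
    simp [he] at this
  · obtain ⟨u, hu, hmin⟩ := (isCompact_sphere (0 : E) 1).exists_isMinOn hne hcont.continuousOn
    have hu0 : 0 < B u u := hB u (by rintro rfl; simp at hu)
    refine ⟨√(1 / B u u), fun v hv => ?_⟩
    refine Real.le_sqrt_of_sq_le ?_
    rw [le_div_iff₀ hu0]
    rcases eq_or_ne v 0 with rfl | hv0
    · simp
    have hn : ‖v‖ ≠ 0 := norm_ne_zero_iff.2 hv0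
    have h1 : ‖v‖⁻¹ • v ∈ Metric.sphere (0 : E) 1 := by
      simp [norm_smul, inv_mul_cancel₀ hn]
    have h2 : B u u ≤ B (‖v‖⁻¹ • v) (‖v‖⁻¹ • v) := hmin h1
    have h3 : ‖v‖ ^ 2 * B (‖v‖⁻¹ • v) (‖v‖⁻¹ • v) = B v v := by
      simp only [map_smul, smul_apply, smul_eq_mul]
      field_simp
    have h4 := mul_le_mul_of_nonneg_left h2 (sq_nonneg ‖v‖)
    simp only [Set.mem_ofPred_eq] at hv
    linarith

/-! ### Metrics and connections given by data in a global chart -/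

section Structures

variable {n : ℕ} {M : Type*} [TopologicalSpace M] [ChartedSpace (EuclideanSpace ℝ (Fin n)) M]
  [IsManifold (𝓡 n) ∞ M]
  {θ : OpenPartialHomeomorph M (EuclideanSpace ℝ (Fin n))}
  (hθ : θ ∈ IsManifold.maximalAtlas (𝓡 n) ∞ M) (hs : θ.source = univ)

/-- A Riemannian metric whose coefficients in a global chart are smooth. -/
def metricOfChart (B : ∀ p : M, TangentSpace (𝓡 n) p →L[ℝ] TangentSpace (𝓡 n) p →L[ℝ] ℝ)
    (hsymm : ∀ p v w, B p v w = B p w v) (hpos : ∀ p v, v ≠ 0 → 0 < B p v v)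
    (hsmooth : ∀ i j, ContMDiff (𝓡 n) 𝓘(ℝ) ∞ fun p => B p (coordVF θ i p) (coordVF θ j p)) :
    Metric n M where
  inner := B
  symm := hsymm
  pos := hpos
  isVonNBounded p := isVonNBounded_of_pos (E := EuclideanSpace ℝ (Fin n)) (B p) (hpos p)
  contMDiff := by
    refine contMDiff_hom_of_coordVF hθ hs B fun i => ?_
    refine contMDiff_hom_of_coordVF (V := Bundle.Trivial M ℝ) hθ hs
      (fun p => B p (coordVF θ i p)) fun j => ?_
    intro p
    rw [Bundle.contMDiffAt_section]
    exact hsmooth i j p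

theorem mfderiv_coord_smul {g : M → ℝ} {σ : ∀ p : M, TangentSpace (𝓡 n) p} {p : M}
    (hσ : MDifferentiableAt (𝓡 n) 𝓘(ℝ, EuclideanSpace ℝ (Fin n))
      (fun q => mvfderiv (𝓡 n) θ q (σ q)) p)
    (hg : MDifferentiableAt (𝓡 n) 𝓘(ℝ, ℝ) g p) (v : TangentSpace (𝓡 n) p) :
    mvfderiv (𝓡 n) (fun q => mvfderiv (𝓡 n) θ q ((g • σ) q)) p v
      = g p • mvfderiv (𝓡 n) (fun q => mvfderiv (𝓡 n) θ q (σ q)) p v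
        + mvfderiv (𝓡 n) g p v • mvfderiv (𝓡 n) θ p (σ p) := by
  have h1 : (fun q => mvfderiv (𝓡 n) θ q ((g • σ) q))
      = fun q => g q • mvfderiv (𝓡 n) θ q (σ q) := 
    funext fun q => (mvfderiv (𝓡 n) θ q).map_smul (g q) (σ q)
  rw [h1, show (fun q => g q • mvfderiv (𝓡 n) θ q (σ q))
    = g • (fun q => mvfderiv (𝓡 n) θ q (σ q)) from rfl, mvfderiv_smul hg hσ]
  rfl

/-- `flatDeriv θ` as a bundled connection. -/
def flatConn : Conn n M where
  toFun := flatDeriv θ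
  isCovariantDerivativeOnUniv :=
    { add := by
        intro σ σ' p hσ hσ' _
        have h1 := mdifferentiableAt_coord hθ hs hσ
        have h2 := mdifferentiableAt_coord hθ hs hσ'
        ext v
        simp only [flatDeriv, ContinuousLinearMap.comp_apply, add_apply]
        rw [← map_add]
        congr 1
        have h3 : (fun q => mvfderiv (𝓡 n) θ q ((σ + σ') q))
          = (fun q => mvfderiv (𝓡 n) θ q (σ q)) + fun q => mvfderiv (𝓡 n) θ q (σ' q) :=
          funext fun q => map_add _ _ _
        rw [h3, mvfderiv_add h1 h2]
        rfl
      leibniz := by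
        intro σ g p hσ hg _
        ext v
        have h1 := mfderiv_coord_smul (θ := θ) (mdifferentiableAt_coord hθ hs hσ) hg v
        simp only [flatDeriv, ContinuousLinearMap.comp_apply, add_apply,
          smul_apply, ContinuousLinearMap.smulRight_apply]
        rw [h1, map_add, map_smul, map_smul, inverse_mvfderiv_chart hθ (by simp [hs])] }

theorem flatConn_apply (W : ∀ p : M, TangentSpace (𝓡 n) p) (p : M) :
    (flatConn hθ hs : Conn n M) W p = flatDeriv θ W p := rfl

include hθ hs in
/-- A connection that maps smooth vector fields to smooth vector fields is smooth. -/
theorem contMDiffCovariantDerivative_of_smooth (conn : Conn n M)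
    (hconn : ∀ V W : ∀ p : M, TangentSpace (𝓡 n) p, IsSmoothVF V → IsSmoothVF W →
      IsSmoothVF fun p => conn W p (V p)) :
    CovariantDerivative.ContMDiffCovariantDerivative conn ∞ where
  contMDiff :=
    { contMDiff := by
        intro σ hσ
        have h1 : IsSmoothVF σ := contMDiffOn_univ.1 hσ
        exact (contMDiff_hom_of_coordVF hθ hs (fun p => conn σ p) fun i =>
          hconn _ _ (isSmoothVF_coordVF hθ hs i) h1).contMDiffOn }

end Structures

/-! ### Rigidity of coordinate representations and existence of a global one -/

section Representations

variable {n : ℕ} {M : Type*} [TopologicalSpace M] [ChartedSpace (EuclideanSpace ℝ (Fin n)) M]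
  {X : Type*} [MeasurableSpace X] [TopologicalSpace X] {μ : Measure X}
  {h τ : ℝ → ℝ} {I : Set ℝ} {dens : M → X → ℝ}
  {θ : OpenPartialHomeomorph M (EuclideanSpace ℝ (Fin n))}
  {T : X → EuclideanSpace ℝ (Fin n)} {c : X → ℝ} {ψ : M → ℝ}

/-- Positivity and finiteness exclude the two conventional values `0` and `⊤`. Hence represented
densities lie in `I` at every `x`, not merely almost everywhere. -/
theorem eq_of_defExp_eq_coe {u t : ℝ} (ht : 0 < t)
    (hu : (t : EReal) = defExp h τ I u) : t ∈ I ∧ ellFun h τ t = u := by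
  unfold defExp at hu
  split_ifs at hu with h1 h2
  · have h3 : t = Function.invFunOn (ellFun h τ) I u := by exact_mod_cast hu
    rw [h3]
    exact ⟨Function.invFunOn_mem h1, Function.invFunOn_eq h1⟩
  · exact absurd hu (EReal.coe_ne_top t)
  · have : t = 0 := by exact_mod_cast hu
    exact absurd this ht.ne'

theorem eq_of_forall_le (hD : IsDensityFamily μ I dens) {p q : M}
    (hpq : ∀ x, dens p x ≤ dens q x) : p = q := by
  refine hD.injective p q ?_
  have h1 : ∫ x, (dens q x - dens p x) ∂μ = 0 := by
    rw [integral_sub (hD.integrable q) (hD.integrable p), hD.integral_eq_one,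
      hD.integral_eq_one, sub_self]
  have h2 := (integral_eq_zero_iff_of_nonneg (fun x => sub_nonneg.2 (hpq x))
    ((hD.integrable q).sub (hD.integrable p))).1 h1
  filter_upwards [h2] with x hx
  exact (sub_eq_zero.1 hx).symm

variable (hadm : IsAdmissible h τ I)
include hadm

namespace IsExpCoordRep

variable (hrep : IsExpCoordRep h τ I dens θ T c ψ) (hpos : ∀ p x, 0 < dens p x)
include hrep hpos

theorem dens_mem {p : M} (hp : p ∈ θ.source) (x : X) : dens p x ∈ I :=
  (eq_of_defExp_eq_coe (hpos p x) (hrep.dens_eq p hp x)).1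

theorem ellFun_dens {p : M} (hp : p ∈ θ.source) (x : X) :
    ellFun h τ (dens p x) = inner ℝ (θ p) (T x) - c x - ψ p :=
  (eq_of_defExp_eq_coe (hpos p x) (hrep.dens_eq p hp x)).2

end IsExpCoordRep

variable (hD : IsDensityFamily μ I dens) (hmem : ∀ p x, dens p x ∈ I)
include hD hmem

/-- By monotonicity of `ℓ` the sign of `k` orders the two densities pointwise, and ordered densities
with equal total mass coincide. This uniqueness of the normalization underlies the rigidity of
representations. -/
theorem eq_of_ellFun_sub_eq_const {p q : M} (k : ℝ)
    (hk : ∀ x, ellFun h τ (dens p x) - ellFun h τ (dens q x) = k) : p = q := by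
  rcases le_total k 0 with hk0 | hk0
  · refine eq_of_forall_le hD fun x => ?_
    rw [← hadm.strictMonoOn_ellFun.le_iff_le (hmem p x) (hmem q x)]
    linarith [hk x]
  · refine (eq_of_forall_le hD fun x => ?_).symm
    rw [← hadm.strictMonoOn_ellFun.le_iff_le (hmem q x) (hmem p x)]
    linarith [hk x]

/-- The components of `T` in a representation are affinely independent. -/
theorem eq_zero_of_inner_eq_const (hrep : IsExpCoordRep h τ I dens θ T c ψ)
    (hne : θ.source.Nonempty) {a : EuclideanSpace ℝ (Fin n)} {k : ℝ}
    (ha : ∀ x, inner ℝ a (T x) = k) : a = 0 := by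
  obtain ⟨p, hp⟩ := hne
  -- A small move along `a` changes `ℓ` by a constant in `x`, so it does not change the point;
  -- injectivity of the chart then gives `a = 0`.
  have h1 : ∀ᶠ s in nhds (0 : ℝ), θ p + s • a ∈ θ.target := by
    have hc : ContinuousAt (fun s : ℝ => θ p + s • a) 0 := by fun_prop
    refine hc.preimage_mem_nhds (θ.open_target.mem_nhds ?_)
    simpa using θ.map_source hp
  have h2 : ∃ s : ℝ, θ p + s • a ∈ θ.target ∧ s ≠ 0 :=
    ((h1.filter_mono nhdsWithin_le_nhds).and self_mem_nhdsWithin :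
      ∀ᶠ s in nhdsWithin (0 : ℝ) {0}ᶜ, _ ∧ _).exists
  obtain ⟨s, hs, hs0⟩ := h2
  have hq := θ.map_target hs
  have h3 : θ.symm (θ p + s • a) = p := by
    refine eq_of_ellFun_sub_eq_const hadm hD hmem
      (s * k - ψ (θ.symm (θ p + s • a)) + ψ p) fun x => ?_
    rw [hrep.ellFun_dens hadm hD.pos hq, hrep.ellFun_dens hadm hD.pos hp, θ.right_inv hs,
      inner_add_left, real_inner_smul_left, ha]
    ring
  have h4 : θ p + s • a = θ p := by rw [← θ.right_inv hs, h3]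
  simpa [hs0] using h4

/-- On the overlap of two representations the maps `T` are related by an affine map. -/
theorem exists_linear_relation {θ' : OpenPartialHomeomorph M (EuclideanSpace ℝ (Fin n))}
    {T' : X → EuclideanSpace ℝ (Fin n)} {c' : X → ℝ} {ψ' : M → ℝ}
    (hrep : IsExpCoordRep h τ I dens θ T c ψ) (hrep' : IsExpCoordRep h τ I dens θ' T' c' ψ')
    {q : M} (hq : q ∈ θ.source) (hq' : q ∈ θ'.source) :
    ∃ (A : EuclideanSpace ℝ (Fin n) →L[ℝ] EuclideanSpace ℝ (Fin n))
      (b : EuclideanSpace ℝ (Fin n)), ∀ x, T' x = A (T x) + b := by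
  have hcoord : ∀ i : Fin n, ∃ (a : EuclideanSpace ℝ (Fin n)) (b : ℝ),
      ∀ x, T' x i = inner ℝ a (T x) + b := by
    intro i
    -- Moving `q` by `s` in the `i`-th coordinate of `θ'` changes `ℓ` by `s · T' x i` plus a
    -- constant; the same change seen in `θ` is `⟨θ r - θ q, T x⟩` plus a constant. Dividing by `s`
    -- gives the relation.
    have h1 : ∀ᶠ s in nhds (0 : ℝ), θ' q + s • EuclideanSpace.single i (1 : ℝ) ∈
        θ'.target ∩ θ'.symm ⁻¹' θ.source := by
      have hc : ContinuousAt (fun s : ℝ => θ' q + s • EuclideanSpace.single i (1 : ℝ)) 0 := by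
        fun_prop
      refine hc.preimage_mem_nhds ((θ'.isOpen_inter_preimage_symm θ.open_source).mem_nhds ?_)
      simpa [θ'.left_inv hq'] using ⟨θ'.map_source hq', hq⟩
    obtain ⟨s, hs, hs0⟩ :=
      ((h1.filter_mono nhdsWithin_le_nhds).and self_mem_nhdsWithin :
        ∀ᶠ s in nhdsWithin (0 : ℝ) {0}ᶜ, _ ∧ _).exists
    have hs0 : s ≠ 0 := hs0
    set r := θ'.symm (θ' q + s • EuclideanSpace.single i (1 : ℝ)) with hr
    have hr' : r ∈ θ'.source := θ'.map_target hs.1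
    refine ⟨s⁻¹ • (θ r - θ q), s⁻¹ * (ψ q - ψ r + ψ' r - ψ' q), fun x => ?_⟩
    have e1 := hrep.ellFun_dens hadm hD.pos hs.2 x
    have e2 := hrep.ellFun_dens hadm hD.pos hq x
    have e3 := hrep'.ellFun_dens hadm hD.pos hr' x
    have e4 := hrep'.ellFun_dens hadm hD.pos hq' x
    rw [← hr] at e1
    rw [hr, θ'.right_inv hs.1, ← hr, inner_add_left, real_inner_smul_left,
      EuclideanSpace.inner_single_left] at e3
    simp only [map_one, one_mul] at e3
    rw [real_inner_smul_left, inner_sub_left]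
    field_simp
    linarith
  choose a b hab using hcoord
  refine ⟨((WithLp.linearEquiv 2 ℝ (Fin n → ℝ)).symm.toLinearMap ∘ₗ
    LinearMap.pi fun i => (innerSL ℝ (a i)).toLinearMap).toContinuousLinearMap,
    WithLp.toLp 2 b, fun x => ?_⟩
  ext i
  simp [hab i x]

/-- Composing the two affine relations shows that `v - A* A'* v` pairs with `T x` to a constant, so
it vanishes by affine independence. -/
theorem comp_adjoint_eq_id {T' : X → EuclideanSpace ℝ (Fin n)}
    (hrep : IsExpCoordRep h τ I dens θ T c ψ) (hne : θ.source.Nonempty)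
    {A A' : EuclideanSpace ℝ (Fin n) →L[ℝ] EuclideanSpace ℝ (Fin n)}
    {b b' : EuclideanSpace ℝ (Fin n)} (hA : ∀ x, T' x = A (T x) + b)
    (hA' : ∀ x, T x = A' (T' x) + b') (v : EuclideanSpace ℝ (Fin n)) :
    A.adjoint (A'.adjoint v) = v := by
  refine (sub_eq_zero.1 (eq_zero_of_inner_eq_const hadm hD hmem hrep hne
    (k := inner ℝ v (A' b + b')) fun x => ?_)).symm
  rw [inner_sub_left, ContinuousLinearMap.adjoint_inner_left,
    ContinuousLinearMap.adjoint_inner_left, ← inner_sub_right]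
  congr 1
  have h1 := hA' x
  rw [hA x, map_add] at h1
  rw [sub_eq_iff_eq_add]
  conv_lhs => rw [h1]
  abel

omit hadm hD hmem in
theorem trans_affine_mem_maximalAtlas [IsManifold (𝓡 n) ∞ M]
    (hθ : θ ∈ IsManifold.maximalAtlas (𝓡 n) ∞ M)
    (L : EuclideanSpace ℝ (Fin n) ≃L[ℝ] EuclideanSpace ℝ (Fin n)) (a : EuclideanSpace ℝ (Fin n)) :
    θ.transHomeomorph (L.toHomeomorph.trans (Homeomorph.addRight a)) ∈
      IsManifold.maximalAtlas (𝓡 n) ∞ M := by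
  refine OpenPartialHomeomorph.mem_maximalAtlas_of_contMDiffOn _ ?_ ?_
  · have h1 : ContMDiff (𝓡 n) (𝓡 n) ∞ (fun y => L y + a) :=
      (L.contDiff.add contDiff_const).contMDiff
    exact h1.comp_contMDiffOn (contMDiffOn_of_mem_maximalAtlas hθ)
  · have h1 : ContMDiff (𝓡 n) (𝓡 n) ∞ (fun y => L.symm (y + -a)) :=
      (L.symm.contDiff.comp (contDiff_id.add contDiff_const)).contMDiff
    exact (contMDiffOn_symm_of_mem_maximalAtlas hθ).comp h1.contMDiffOn (fun y hy => hy)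

/-- A representation can be rewritten with the functions `T`, `c` of an overlapping one. -/
theorem exists_rep_of_overlap [IsManifold (𝓡 n) ∞ M]
    {θ' : OpenPartialHomeomorph M (EuclideanSpace ℝ (Fin n))}
    {T' : X → EuclideanSpace ℝ (Fin n)} {c' : X → ℝ} {ψ' : M → ℝ}
    (hrep : IsExpCoordRep h τ I dens θ T c ψ) (hrep' : IsExpCoordRep h τ I dens θ' T' c' ψ')
    {q : M} (hq : q ∈ θ.source) (hq' : q ∈ θ'.source) :
    ∃ (θ₁ : OpenPartialHomeomorph M (EuclideanSpace ℝ (Fin n))) (ψ₁ : M → ℝ),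
      IsExpCoordRep h τ I dens θ₁ T c ψ₁ ∧ θ₁.source = θ'.source := by
  obtain ⟨A, b, hA⟩ := exists_linear_relation hadm hD hmem hrep hrep' hq hq'
  obtain ⟨A', b', hA'⟩ := exists_linear_relation hadm hD hmem hrep' hrep hq' hq
  let L : EuclideanSpace ℝ (Fin n) ≃L[ℝ] EuclideanSpace ℝ (Fin n) :=
    ContinuousLinearEquiv.equivOfInverse A.adjoint A'.adjoint
      (comp_adjoint_eq_id hadm hD hmem hrep' ⟨q, hq'⟩ hA' hA)
      (comp_adjoint_eq_id hadm hD hmem hrep ⟨q, hq⟩ hA hA')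
  -- Equating both formulas for `ℓ` at `q` expresses `c'` through `c`. Substituting this into the
  -- formula of `θ'` at a general point dictates `a` and `k`.
  set a := θ q - A.adjoint (θ' q) with ha
  set k := ψ q + inner ℝ (θ' q) b - ψ' q with hk
  have hθ' := contMDiffOn_of_mem_maximalAtlas hrep'.mem_atlas
  refine ⟨θ'.transHomeomorph (L.toHomeomorph.trans (Homeomorph.addRight a)),
    fun p => ψ' p + (k - inner ℝ (θ' p) b),
    ⟨trans_affine_mem_maximalAtlas hrep'.mem_atlas L a, hrep.continuous_T, hrep.continuous_c,
      ?_, fun p hp x => ?_⟩, rfl⟩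
  · have h1 : ContMDiff (𝓡 n) 𝓘(ℝ) ∞ (fun y : EuclideanSpace ℝ (Fin n) => k - inner ℝ y b) :=
      (contDiff_const.sub (contDiff_id.inner ℝ contDiff_const)).contMDiff
    exact hrep'.smooth_psi.add (h1.comp_contMDiffOn hθ')
  · have hp' : p ∈ θ'.source := hp
    rw [hrep'.dens_eq p hp' x]
    congr 1
    have e1 := hrep.ellFun_dens hadm hD.pos hq x
    have e2 := hrep'.ellFun_dens hadm hD.pos hq' x
    have e3 : (θ'.transHomeomorph (L.toHomeomorph.trans (Homeomorph.addRight a))) p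
      = A.adjoint (θ' p) + a := rfl
    rw [e3, ha, inner_add_left, inner_sub_left, ContinuousLinearMap.adjoint_inner_left,
      ContinuousLinearMap.adjoint_inner_left, hA x, inner_add_right]
    rw [hA x, inner_add_right] at e2
    linarith

/-- Two representations with the same functions `T`, `c` agree where both are defined. -/
theorem rep_unique [Nonempty X] {θ' : OpenPartialHomeomorph M (EuclideanSpace ℝ (Fin n))}
    {ψ' : M → ℝ} (hrep : IsExpCoordRep h τ I dens θ T c ψ)
    (hrep' : IsExpCoordRep h τ I dens θ' T c ψ') {q : M} (hq : q ∈ θ.source)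
    (hq' : q ∈ θ'.source) : θ q = θ' q ∧ ψ q = ψ' q := by
  have h1 : θ q = θ' q := by
    refine sub_eq_zero.1 (eq_zero_of_inner_eq_const hadm hD hmem hrep ⟨q, hq⟩
      (k := ψ q - ψ' q) fun x => ?_)
    have e1 := hrep.ellFun_dens hadm hD.pos hq x
    have e2 := hrep'.ellFun_dens hadm hD.pos hq' x
    rw [inner_sub_left]
    linarith
  refine ⟨h1, ?_⟩
  obtain ⟨x⟩ := ‹Nonempty X›
  have e1 := hrep.ellFun_dens hadm hD.pos hq x
  have e2 := hrep'.ellFun_dens hadm hD.pos hq' x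
  rw [h1] at e1
  linarith

omit hmem in
/-- An exponential family on a connected manifold has a global representation. -/
theorem exists_global_rep [IsManifold (𝓡 n) ∞ M] [ConnectedSpace M] [Nonempty X]
    (hloc : ∀ p : M, ∃ (θ : OpenPartialHomeomorph M (EuclideanSpace ℝ (Fin n)))
      (T : X → EuclideanSpace ℝ (Fin n)) (c : X → ℝ) (ψ : M → ℝ),
      IsExpCoordRep h τ I dens θ T c ψ ∧ p ∈ θ.source) :
    ∃ (θ : OpenPartialHomeomorph M (EuclideanSpace ℝ (Fin n)))
      (T : X → EuclideanSpace ℝ (Fin n)) (c : X → ℝ) (ψ : M → ℝ),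
      IsExpCoordRep h τ I dens θ T c ψ ∧ θ.source = univ := by
  have hmem : ∀ p x, dens p x ∈ I := fun p x => by
    obtain ⟨θ, T, c, ψ, hrep, hp⟩ := hloc p
    exact hrep.dens_mem hadm hD.pos hp x
  obtain ⟨p₀⟩ := (inferInstance : Nonempty M)
  obtain ⟨θ₀, T, c, ψ₀, hrep₀, hp₀⟩ := hloc p₀
  have hall : ∀ p : M, ∃ (θ : OpenPartialHomeomorph M (EuclideanSpace ℝ (Fin n))) (ψ : M → ℝ),
      IsExpCoordRep h τ I dens θ T c ψ ∧ p ∈ θ.source := by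
    set P := {p : M | ∃ (θ : OpenPartialHomeomorph M (EuclideanSpace ℝ (Fin n))) (ψ : M → ℝ),
      IsExpCoordRep h τ I dens θ T c ψ ∧ p ∈ θ.source} with hP
    have hopen : IsOpen P := by
      rw [isOpen_iff_mem_nhds]
      rintro p ⟨θ, ψ, hrep, hp⟩
      filter_upwards [θ.open_source.mem_nhds hp] with q hq
      exact ⟨θ, ψ, hrep, hq⟩
    -- If a representation around `p` meets `P` at some `q`, it can be rewritten with `T` and `c` on
    -- its whole domain, which puts `p` in `P`.
    have hclosed : IsClosed P := by
      rw [← isOpen_compl_iff, isOpen_iff_mem_nhds]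
      intro p hp
      obtain ⟨θ, T', c', ψ, hrep, hpθ⟩ := hloc p
      filter_upwards [θ.open_source.mem_nhds hpθ] with q hq
      rintro ⟨θ', ψ', hrep', hq'⟩
      obtain ⟨θ₁, ψ₁, h1, h2⟩ := exists_rep_of_overlap hadm hD hmem hrep' hrep hq' hq
      exact hp ⟨θ₁, ψ₁, h1, h2 ▸ hpθ⟩
    have := IsClopen.eq_univ ⟨hclosed, hopen⟩ ⟨p₀, θ₀, ψ₀, hrep₀, hp₀⟩
    intro p
    exact (this.symm ▸ mem_univ p : p ∈ P)
  -- Now that `T` and `c` are fixed, the chosen charts agree on overlaps and glue to one map `f`;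
  -- equal values of `f` give `ℓ`-values differing by a constant, so `f` is injective.
  choose Θ Ψ hΘ hΘp using hall
  set f : M → EuclideanSpace ℝ (Fin n) := fun p => Θ p p with hf
  set ψ : M → ℝ := fun p => Ψ p p with hψ
  have hfeq : ∀ p, ∀ q ∈ (Θ p).source, f q = Θ p q ∧ ψ q = Ψ p q := fun p q hq =>
    rep_unique hadm hD hmem (hΘ q) (hΘ p) (hΘp q) hq
  have hfev : ∀ p, f =ᶠ[nhds p] Θ p := fun p => by
    filter_upwards [(Θ p).open_source.mem_nhds (hΘp p)] with q hq using (hfeq p q hq).1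
  have hψev : ∀ p, ψ =ᶠ[nhds p] Ψ p := fun p => by
    filter_upwards [(Θ p).open_source.mem_nhds (hΘp p)] with q hq using (hfeq p q hq).2
  have hell : ∀ p x, ellFun h τ (dens p x) = inner ℝ (f p) (T x) - c x - ψ p := fun p x =>
    (hΘ p).ellFun_dens hadm hD.pos (hΘp p) x
  have hsm : ContMDiff (𝓡 n) (𝓡 n) ∞ f := fun p =>
    (contMDiffAt_of_mem_maximalAtlas (hΘ p).mem_atlas (hΘp p)).congr_of_eventuallyEq (hfev p)
  have hinj : Function.Injective f := fun p q hpq =>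
    eq_of_ellFun_sub_eq_const hadm hD hmem (ψ q - ψ p) fun x => by
      rw [hell, hell, hpq]; ring
  have hopen : IsOpenMap f := by
    rw [isOpenMap_iff_nhds_le]
    intro p
    rw [Filter.map_congr (hfev p), (Θ p).map_nhds_eq (hΘp p)]
  have hemb := Topology.IsOpenEmbedding.of_continuous_injective_isOpenMap hsm.continuous hinj hopen
  refine ⟨hemb.toOpenPartialHomeomorph f, T, c, ψ, ⟨?_, hrep₀.continuous_T, hrep₀.continuous_c,
    fun p _ => ?_, fun p _ x => ?_⟩, rfl⟩
  · refine OpenPartialHomeomorph.mem_maximalAtlas_of_contMDiffOn _ hsm.contMDiffOn ?_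
    rintro y hy
    obtain ⟨p, rfl⟩ : ∃ p, f p = y := by simpa using hy
    have hfp : f p ∈ (Θ p).target := (Θ p).map_source (hΘp p)
    refine ContMDiffAt.contMDiffWithinAt ((contMDiffAt_symm_of_mem_maximalAtlas
      (hΘ p).mem_atlas hfp).congr_of_eventuallyEq ?_)
    filter_upwards [(Θ p).open_target.mem_nhds hfp] with z hz
    have h1 : f ((Θ p).symm z) = z := by
      rw [(hfeq p _ ((Θ p).map_target hz)).1, (Θ p).right_inv hz]
    conv_lhs => rw [← h1]
    exact (hemb.toOpenPartialHomeomorph f).left_inv (mem_univ _)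
  · exact (((hΘ p).smooth_psi.contMDiffAt ((Θ p).open_source.mem_nhds
      (hΘp p))).congr_of_eventuallyEq (hψev p)).contMDiffWithinAt
  · exact (hΘ p).dens_eq p (hΘp p) x

end Representations

/-! ### Pointwise identities in a global representation -/

section GlobalFamilies

variable {n : ℕ} {M : Type*} [TopologicalSpace M] [ChartedSpace (EuclideanSpace ℝ (Fin n)) M]
  [IsManifold (𝓡 n) ∞ M] {X : Type*} [MeasurableSpace X] [TopologicalSpace X]

/-- A compatible exponential family with constant `τ/χ = lam > 0`, with a global coordinate
representation. -/
structure IsGlobalFamily (μ : Measure X) (h τ : ℝ → ℝ) (I : Set ℝ) (dens : M → X → ℝ)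
    (θ : OpenPartialHomeomorph M (EuclideanSpace ℝ (Fin n)))
    (T : X → EuclideanSpace ℝ (Fin n)) (c : X → ℝ) (ψ : M → ℝ) (lam : ℝ) : Prop where
  adm : IsAdmissible h τ I
  lam_pos : 0 < lam
  tau_div_chi : ∀ t ∈ I, τ t / chiFun h τ t = lam
  fam : IsExpFamily n μ h τ I dens
  comp : IsCompatible n μ h τ dens
  rep : IsExpCoordRep h τ I dens θ T c ψ
  source_eq : θ.source = univ

namespace IsGlobalFamily

variable {μ : Measure X} {h τ : ℝ → ℝ} {I : Set ℝ} {dens : M → X → ℝ}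
  {θ : OpenPartialHomeomorph M (EuclideanSpace ℝ (Fin n))}
  {T : X → EuclideanSpace ℝ (Fin n)} {c : X → ℝ} {ψ : M → ℝ} {lam : ℝ}
  (G : IsGlobalFamily μ h τ I dens θ T c ψ lam)
include G

theorem mem_source (p : M) : p ∈ θ.source := by simp [G.source_eq]

theorem dens_mem (p : M) (x : X) : dens p x ∈ I :=
  G.rep.dens_mem G.adm G.fam.pos (G.mem_source p) x

theorem ellFun_dens (p : M) (x : X) :
    ellFun h τ (dens p x) = inner ℝ (θ p) (T x) - c x - ψ p :=
  G.rep.ellFun_dens G.adm G.fam.pos (G.mem_source p) x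

theorem contMDiff_psi : ContMDiff (𝓡 n) 𝓘(ℝ) ∞ ψ := by
  have := G.rep.smooth_psi
  rwa [G.source_eq, contMDiffOn_univ] at this

theorem contMDiff_ellFun_dens (x : X) :
    ContMDiff (𝓡 n) 𝓘(ℝ) ∞ (fun p => ellFun h τ (dens p x)) := by
  have h1 : ContMDiff (𝓡 n) 𝓘(ℝ) ∞ (fun p => inner ℝ (θ p) (T x)) := by
    have h2 : ContMDiff (𝓡 n) 𝓘(ℝ) ∞ (fun y : EuclideanSpace ℝ (Fin n) => inner ℝ y (T x)) :=
      (contDiff_id.inner ℝ contDiff_const).contMDiff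
    exact h2.comp (contMDiff_chart G.rep.mem_atlas G.source_eq)
  simp only [G.ellFun_dens]
  exact (h1.sub contMDiff_const).sub G.contMDiff_psi

theorem mdifferentiableAt_inner {w : M → EuclideanSpace ℝ (Fin n)} {p : M}
    (hw : MDifferentiableAt (𝓡 n) 𝓘(ℝ, EuclideanSpace ℝ (Fin n)) w p)
    (a : EuclideanSpace ℝ (Fin n)) :
    MDifferentiableAt (𝓡 n) 𝓘(ℝ) (fun q => inner ℝ (w q) a) p := by
  have h2 : DifferentiableAt ℝ (fun y : EuclideanSpace ℝ (Fin n) => inner ℝ y a) (w p) :=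
    differentiableAt_id.inner ℝ (differentiableAt_const _)
  exact h2.mdifferentiableAt.comp p hw

theorem mvfderiv_inner {w : M → EuclideanSpace ℝ (Fin n)} {p : M}
    (hw : MDifferentiableAt (𝓡 n) 𝓘(ℝ, EuclideanSpace ℝ (Fin n)) w p)
    (a : EuclideanSpace ℝ (Fin n)) (v : TangentSpace (𝓡 n) p) :
    mvfderiv (𝓡 n) (fun q => inner ℝ (w q) a) p v = inner ℝ (mvfderiv (𝓡 n) w p v) a := by
  have h1 : (fun q => inner ℝ (w q) a) = fun q => innerSL ℝ a (w q) := by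
    funext q; simp [real_inner_comm]
  rw [h1, mvfderiv_comp_fderiv (innerSL ℝ a).differentiableAt hw, ContinuousLinearMap.fderiv]
  simp [real_inner_comm]

theorem mvfderiv_ellFun_dens (p : M) (x : X) (v : TangentSpace (𝓡 n) p) :
    mvfderiv (𝓡 n) (fun q => ellFun h τ (dens q x)) p v
      = inner ℝ (mvfderiv (𝓡 n) θ p v) (T x) - mvfderiv (𝓡 n) ψ p v := by
  have hθ := mdifferentiableAt_chart G.rep.mem_atlas (G.mem_source p)
  have hψ := G.contMDiff_psi.mdifferentiableAt (x := p) (by simp)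
  have h1 := G.mdifferentiableAt_inner hθ (T x)
  simp only [G.ellFun_dens]
  rw [show (fun q => inner ℝ (θ q) (T x) - c x - ψ q) = 
    ((fun q => inner ℝ (θ q) (T x)) - fun _ => c x) - ψ from rfl,
    mvfderiv_sub (h1.sub mdifferentiableAt_const) hψ, mvfderiv_sub h1 mdifferentiableAt_const,
    mvfderiv_const]
  simp only [sub_apply, sub_zero]
  rw [G.mvfderiv_inner hθ]

/-- The second derivative of `ℓ ∘ e_x` does not depend on `x`, up to first order terms. -/
theorem mvfderiv_mvfderiv_ellFun_dens {W : ∀ p : M, TangentSpace (𝓡 n) p} (hW : IsSmoothVF W)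
    (p : M) (x : X) (v : TangentSpace (𝓡 n) p) :
    mvfderiv (𝓡 n) (fun q => mvfderiv (𝓡 n) (fun q => ellFun h τ (dens q x)) q (W q)) p v
      = mvfderiv (𝓡 n) (fun q => ellFun h τ (dens q x)) p (flatDeriv θ W p v)
        - coordHess θ ψ p v (W p) := by
  have hW' := contMDiff_coord G.rep.mem_atlas G.source_eq hW
  have hd := hW'.mdifferentiableAt (x := p) (by simp)
  have h1 : MDifferentiableAt (𝓡 n) 𝓘(ℝ)
      (fun q => inner ℝ (mvfderiv (𝓡 n) θ q (W q)) (T x)) p :=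
    G.mdifferentiableAt_inner hd _
  have h3 := (contMDiff_mvfderiv_apply G.rep.mem_atlas G.source_eq G.contMDiff_psi
    hW).mdifferentiableAt (x := p) (by simp)
  simp only [G.mvfderiv_ellFun_dens]
  rw [show (fun q => inner ℝ (mvfderiv (𝓡 n) θ q (W q)) (T x) - mvfderiv (𝓡 n) ψ q (W q)) =
    (fun q => inner ℝ (mvfderiv (𝓡 n) θ q (W q)) (T x)) - fun q => mvfderiv (𝓡 n) ψ q (W q)
    from rfl, mvfderiv_sub h1 h3]
  simp only [sub_apply]
  rw [G.mvfderiv_inner hd, mvfderiv_mvfderiv G.rep.mem_atlas G.source_eq G.contMDiff_psi hW,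
    mvfderiv_chart_flatDeriv G.rep.mem_atlas G.source_eq]
  ring

theorem tau_pos (p : M) (x : X) : 0 < τ (dens p x) :=
  G.adm.tau_pos G.tau_div_chi G.lam_pos (G.dens_mem p x)

section Pointwise

variable {x : X} (hx : ContMDiff (𝓡 n) 𝓘(ℝ) ∞ (fun p : M => dens p x))
include hx

/-- Chain rule and `τ ℓ' = λ`. The right side is the kind of term whose integral the axioms of a
statistical model annihilate. -/
theorem tau_mul_mvfderiv_ellFun_dens (p : M) (v : TangentSpace (𝓡 n) p) :
    τ (dens p x) * mvfderiv (𝓡 n) (fun q => ellFun h τ (dens q x)) p v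
      = lam * mvfderiv (𝓡 n) (fun q => dens q x) p v := by
  have hI := G.dens_mem p x
  rw [mvfderiv_comp_fderiv (f := fun q => dens q x) (G.adm.hasDerivAt_ellFun hI).differentiableAt
    (hx.mdifferentiableAt (by simp)), fderiv_eq_smul_deriv, smul_eq_mul,
    ← G.adm.tau_mul_deriv_ellFun G.tau_div_chi hI]
  ring

theorem mvfderiv_tau_dens (p : M) (v : TangentSpace (𝓡 n) p) :
    mvfderiv (𝓡 n) (fun q => τ (dens q x)) p v
      = deriv τ (dens p x) * mvfderiv (𝓡 n) (fun q => dens q x) p v := by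
  have hI := G.dens_mem p x
  rw [mvfderiv_comp_fderiv (f := fun q => dens q x) (G.adm.hasDerivAt_tau hI).differentiableAt
    (hx.mdifferentiableAt (by simp)), fderiv_eq_smul_deriv, smul_eq_mul]
  ring

theorem mdifferentiableAt_tau_dens (p : M) :
    MDifferentiableAt (𝓡 n) 𝓘(ℝ) (fun q => τ (dens q x)) p :=
  (G.adm.hasDerivAt_tau (G.dens_mem p x)).differentiableAt.mdifferentiableAt.comp p
    (hx.mdifferentiableAt (by simp))

/-- In the second slot the closed form of `d` has derivative `(τ(e_x q) - τ(e_x p)) · W(ℓ∘e_x)`,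
because `λ W e_x = τ(e_x) W(ℓ∘e_x)`. The first slot then enters only through `τ(e_x p)`. -/
theorem dirFst_dirSnd_dEval (V W : ∀ p : M, TangentSpace (𝓡 n) p) (p : M) :
    dirFst V (dirSnd W (dEval h τ dens x)) (p, p)
      = -(mvfderiv (𝓡 n) (fun q => τ (dens q x)) p (V p)
        * mvfderiv (𝓡 n) (fun q => ellFun h τ (dens q x)) p (W p)) := by
  have hu := fun q => (G.contMDiff_ellFun_dens x).mdifferentiableAt (x := q) (by simp)
  have he := fun q => hx.mdifferentiableAt (x := q) (by simp)
  have ht := G.mdifferentiableAt_tau_dens hx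
  have h1 : ∀ p q, dirSnd W (dEval h τ dens x) (p, q) = (τ (dens q x) - τ (dens p x))
      * mvfderiv (𝓡 n) (fun q => ellFun h τ (dens q x)) q (W q) := by
    intro p q
    have h2 : (fun q => dEval h τ dens x (p, q)) =
        (fun _ => τ (dens p x)) * ((fun _ => ellFun h τ (dens p x)) -
          fun q => ellFun h τ (dens q x)) - (fun _ => lam) * ((fun _ => dens p x) -
          fun q => dens q x) := funext fun q =>
      G.adm.dFun_eq G.tau_div_chi (G.dens_mem p x) (G.dens_mem q x)
    simp only [dirSnd, dir]
    rw [h2, mvfderiv_sub (mdifferentiableAt_const.mul (mdifferentiableAt_const.sub (hu q)))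
      (mdifferentiableAt_const.mul (mdifferentiableAt_const.sub (he q))),
      mvfderiv_mul mdifferentiableAt_const (mdifferentiableAt_const.sub (hu q)),
      mvfderiv_mul mdifferentiableAt_const (mdifferentiableAt_const.sub (he q)),
      mvfderiv_sub mdifferentiableAt_const (hu q), mvfderiv_sub mdifferentiableAt_const (he q)]
    simp only [mvfderiv_const, smul_zero, add_zero, zero_sub, sub_apply, smul_apply, neg_apply,
      smul_eq_mul]
    have := G.tau_mul_mvfderiv_ellFun_dens hx q (W q)
    linear_combination -this
  simp only [dirFst, dir, h1]
  have h3 := mvfderiv_mul (x := p) ((mdifferentiableAt_const (c := τ (dens p x))).sub (ht p))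
    (mdifferentiableAt_const (I := 𝓡 n)
      (c := mvfderiv (𝓡 n) (fun q => ellFun h τ (dens q x)) p (W p)))
  rw [mvfderiv_sub mdifferentiableAt_const (ht p)] at h3
  refine (congrArg (fun L : TangentSpace (𝓡 n) p →L[ℝ] ℝ => L (V p)) h3).trans ?_
  simp only [mvfderiv_const, smul_zero, zero_add, zero_sub, smul_apply, neg_apply,
      smul_eq_mul]
  ring

/-- Differentiating the first slot leaves `W(τ∘e_x) · (ℓ(e_x p) - ℓ(e_x q))`, so both later
derivatives fall on `ℓ∘e_x` alone. -/
theorem dirSnd_dirSnd_dirFst_dEval (Z V W : ∀ p : M, TangentSpace (𝓡 n) p) (hV : IsSmoothVF V)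
    (p : M) : dirSnd Z (dirSnd V (dirFst W (dEval h τ dens x))) (p, p)
      = -(mvfderiv (𝓡 n) (fun q => τ (dens q x)) p (W p)
        * mvfderiv (𝓡 n) (fun q => mvfderiv (𝓡 n) (fun q => ellFun h τ (dens q x)) q (V q))
          p (Z p)) := by
  have hu := fun q => (G.contMDiff_ellFun_dens x).mdifferentiableAt (x := q) (by simp)
  have he := fun q => hx.mdifferentiableAt (x := q) (by simp)
  have ht := G.mdifferentiableAt_tau_dens hx
  have h1 : ∀ p q, dirFst W (dEval h τ dens x) (p, q) =
      mvfderiv (𝓡 n) (fun q => τ (dens q x)) p (W p)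
        * (ellFun h τ (dens p x) - ellFun h τ (dens q x)) := by
    intro p q
    have h2 : (fun p => dEval h τ dens x (p, q)) =
        (fun p => τ (dens p x)) * ((fun p => ellFun h τ (dens p x)) -
          fun _ => ellFun h τ (dens q x)) - (fun _ => lam) * ((fun p => dens p x) -
          fun _ => dens q x) := funext fun p =>
      G.adm.dFun_eq G.tau_div_chi (G.dens_mem p x) (G.dens_mem q x)
    simp only [dirFst, dir]
    rw [h2, mvfderiv_sub ((ht p).mul ((hu p).sub mdifferentiableAt_const))
      (mdifferentiableAt_const.mul ((he p).sub mdifferentiableAt_const)),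
      mvfderiv_mul (ht p) ((hu p).sub mdifferentiableAt_const),
      mvfderiv_mul mdifferentiableAt_const ((he p).sub mdifferentiableAt_const),
      mvfderiv_sub (hu p) mdifferentiableAt_const, mvfderiv_sub (he p) mdifferentiableAt_const]
    simp only [mvfderiv_const, smul_zero, add_zero, sub_zero, sub_apply, smul_apply, add_apply,
      smul_eq_mul, Pi.sub_apply]
    have := G.tau_mul_mvfderiv_ellFun_dens hx p (W p)
    linear_combination this
  have h2 : ∀ p q, dirSnd V (dirFst W (dEval h τ dens x)) (p, q) =
      -mvfderiv (𝓡 n) (fun q => τ (dens q x)) p (W p)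
        * mvfderiv (𝓡 n) (fun q => ellFun h τ (dens q x)) q (V q) := by
    intro p q
    simp only [dirSnd, dir, h1]
    have h3 := mvfderiv_mul (x := q) (mdifferentiableAt_const (I := 𝓡 n)
      (c := mvfderiv (𝓡 n) (fun q => τ (dens q x)) p (W p)))
      ((mdifferentiableAt_const (c := ellFun h τ (dens p x))).sub (hu q))
    rw [mvfderiv_sub mdifferentiableAt_const (hu q)] at h3
    refine (congrArg (fun L : TangentSpace (𝓡 n) q →L[ℝ] ℝ => L (V q)) h3).trans ?_
    simp only [mvfderiv_const, smul_zero, add_zero, zero_sub, smul_apply, neg_apply,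
      smul_eq_mul]
    ring
  have h4 := (contMDiff_mvfderiv_apply G.rep.mem_atlas G.source_eq (G.contMDiff_ellFun_dens x)
    hV).mdifferentiableAt (x := p) (by simp)
  rw [dirSnd, dir]
  simp only [h2]
  have h3 := mvfderiv_mul (x := p) (mdifferentiableAt_const (I := 𝓡 n)
      (c := -mvfderiv (𝓡 n) (fun q => τ (dens q x)) p (W p))) h4
  refine (congrArg (fun L : TangentSpace (𝓡 n) p →L[ℝ] ℝ => L (Z p)) h3).trans ?_
  simp only [mvfderiv_const, smul_zero, add_zero, smul_apply, smul_eq_mul]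
  ring

/-- Derivative along `v` of `λ W e_x = τ(e_x) W(ℓ∘e_x)`, with the second derivative of `ℓ∘e_x` split
off. After integration the two terms with `λ` disappear, and the metric is left against `τ(e_x) ·
Hess ψ`. -/
theorem lam_mul_mvfderiv_dir_dens {W : ∀ p : M, TangentSpace (𝓡 n) p} (hW : IsSmoothVF W) (p : M)
    (v : TangentSpace (𝓡 n) p) :
    lam * mvfderiv (𝓡 n) (dir W (fun q => dens q x)) p v
      = mvfderiv (𝓡 n) (fun q => τ (dens q x)) p v
          * mvfderiv (𝓡 n) (fun q => ellFun h τ (dens q x)) p (W p)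
        + lam * mvfderiv (𝓡 n) (fun q => dens q x) p (flatDeriv θ W p v)
        - τ (dens p x) * coordHess θ ψ p v (W p) := by
  have hW1 := (contMDiff_mvfderiv_apply G.rep.mem_atlas G.source_eq (G.contMDiff_ellFun_dens x)
    hW).mdifferentiableAt (x := p) (by simp)
  have hW2 := (contMDiff_mvfderiv_apply G.rep.mem_atlas G.source_eq hx
    hW).mdifferentiableAt (x := p) (by simp)
  have h1 : (fun _ => lam) * (fun q => mvfderiv (𝓡 n) (fun q => dens q x) q (W q))
      = (fun q => τ (dens q x)) *
        fun q => mvfderiv (𝓡 n) (fun q => ellFun h τ (dens q x)) q (W q) :=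
    funext fun q => (G.tau_mul_mvfderiv_ellFun_dens hx q (W q)).symm
  have h2 := congrArg (fun f => mvfderiv (𝓡 n) f p v) h1
  rw [mvfderiv_mul mdifferentiableAt_const hW2,
    mvfderiv_mul (G.mdifferentiableAt_tau_dens hx p) hW1] at h2
  simp only [mvfderiv_const, smul_zero, add_zero, smul_apply, add_apply, smul_eq_mul] at h2
  rw [G.mvfderiv_mvfderiv_ellFun_dens hW] at h2
  have h3 := G.tau_mul_mvfderiv_ellFun_dens hx p (flatDeriv θ W p v)
  have h4 : dir W (fun q => dens q x)
    = fun q => mvfderiv (𝓡 n) (fun q => dens q x) q (W q) := rfl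
  rw [h4]
  linear_combination h2 + h3

end Pointwise

end IsGlobalFamily

end GlobalFamilies

/-! ### Integrated identities: metric, mean, divergence, connection -/

section Integrals

variable {n : ℕ} {M : Type*} [TopologicalSpace M] [ChartedSpace (EuclideanSpace ℝ (Fin n)) M]
  [IsManifold (𝓡 n) ∞ M] {X : Type*} [MeasurableSpace X] [TopologicalSpace X]

theorem integral_add_sub {μ : Measure X} {f g k : X → ℝ} (hf : Integrable f μ)
    (hg : Integrable g μ) (hk : Integrable k μ) :
    ∫ x, (f x + g x - k x) ∂μ = ∫ x, f x ∂μ + ∫ x, g x ∂μ - ∫ x, k x ∂μ := by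
  rw [integral_sub (f := fun x => f x + g x) (hf.add hg) hk, integral_add hf hg]

namespace IsGlobalFamily

variable {μ : Measure X} {h τ : ℝ → ℝ} {I : Set ℝ} {dens : M → X → ℝ}
  {θ : OpenPartialHomeomorph M (EuclideanSpace ℝ (Fin n))}
  {T : X → EuclideanSpace ℝ (Fin n)} {c : X → ℝ} {ψ : M → ℝ} {lam : ℝ}
  (G : IsGlobalFamily μ h τ I dens θ T c ψ lam)
include G

theorem ae_contMDiff : ∀ᵐ x ∂μ, ContMDiff (𝓡 n) 𝓘(ℝ) ∞ (fun p : M => dens p x) := by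
  obtain ⟨N, hN, -, hsm, -⟩ := G.fam.exists_null
  filter_upwards [measure_eq_zero_iff_ae_notMem.1 hN] with x hx using hsm x hx

theorem contMDiff_coordHess {V W : ∀ p : M, TangentSpace (𝓡 n) p} (hV : IsSmoothVF V)
    (hW : IsSmoothVF W) : ContMDiff (𝓡 n) 𝓘(ℝ) ∞ fun p => coordHess θ ψ p (V p) (W p) := by
  have hθ := G.rep.mem_atlas
  have hs := G.source_eq
  have h1 := contMDiff_mvfderiv_apply hθ hs (contMDiff_mvfderiv_apply hθ hs G.contMDiff_psi hW) hV
  have h2 := contMDiff_mvfderiv_apply hθ hs G.contMDiff_psi (isSmoothVF_flatDeriv hθ hs hV hW)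
  refine (h1.sub h2).congr fun p => ?_
  rw [mvfderiv_mvfderiv hθ hs G.contMDiff_psi hW]
  ring

theorem integrable_mvfderiv_mul {V W : ∀ p : M, TangentSpace (𝓡 n) p} (hV : IsSmoothVF V)
    (hW : IsSmoothVF W) (p : M) :
    Integrable (fun x => mvfderiv (𝓡 n) (fun q => τ (dens q x)) p (V p)
      * mvfderiv (𝓡 n) (fun q => ellFun h τ (dens q x)) p (W p)) μ := by
  refine ((G.comp.integrable_metric V W hV hW p).neg).congr ?_
  filter_upwards [G.ae_contMDiff] with x hx
  rw [Pi.neg_apply, G.dirFst_dirSnd_dEval hx, neg_neg]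

theorem gForm_eq_integral (V W : ∀ p : M, TangentSpace (𝓡 n) p) (p : M) :
    gForm μ h τ dens V W p = ∫ x, mvfderiv (𝓡 n) (fun q => τ (dens q x)) p (V p)
      * mvfderiv (𝓡 n) (fun q => ellFun h τ (dens q x)) p (W p) ∂μ := by
  rw [gForm, ← integral_neg]
  refine integral_congr_ae ?_
  filter_upwards [G.ae_contMDiff] with x hx
  rw [G.dirFst_dirSnd_dEval hx, neg_neg]

/-- Every other term of `lam_mul_mvfderiv_dir_dens` is integrable by hypothesis, hence so is this
one. The equation does not presuppose integrability of `τ∘p`, since a constant factor may always be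
pulled out of the Bochner integral. -/
theorem integrable_tau_mul_coordHess {V W : ∀ p : M, TangentSpace (𝓡 n) p} (hV : IsSmoothVF V)
    (hW : IsSmoothVF W) (p : M) :
    Integrable (fun x => τ (dens p x) * coordHess θ ψ p (V p) (W p)) μ ∧
      gForm μ h τ dens V W p = meanFun μ dens τ p * coordHess θ ψ p (V p) (W p) := by
  have h1 := G.integrable_mvfderiv_mul hV hW p
  have h2 := (G.fam.integrable_dir p (flatDeriv θ W p (V p))).const_mul lam
  have h3 := (G.fam.integrable_dir_dir W hW p (V p)).const_mul lam
  have h4 : (fun x => τ (dens p x) * coordHess θ ψ p (V p) (W p)) =ᵐ[μ]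
      fun x => mvfderiv (𝓡 n) (fun q => τ (dens q x)) p (V p)
      * mvfderiv (𝓡 n) (fun q => ellFun h τ (dens q x)) p (W p)
      + lam * mvfderiv (𝓡 n) (fun q => dens q x) p (flatDeriv θ W p (V p))
      - lam * mvfderiv (𝓡 n) (dir W (fun q => dens q x)) p (V p) := by
    filter_upwards [G.ae_contMDiff] with x hx
    have := G.lam_mul_mvfderiv_dir_dens hx hW p (V p)
    linear_combination this
  refine ⟨((h1.add h2).sub h3).congr h4.symm, ?_⟩
  rw [meanFun, ← integral_mul_const, integral_congr_ae h4, integral_add_sub h1 h2 h3, integral_const_mul, integral_const_mul, G.fam.integral_dir,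
    G.fam.integral_dir_dir W hW, G.gForm_eq_integral]
  simp

theorem exists_isSmoothVF (p : M) (v : TangentSpace (𝓡 n) p) :
    ∃ V : ∀ p : M, TangentSpace (𝓡 n) p, IsSmoothVF V ∧ V p = v :=
  ⟨fun q => (mvfderiv (𝓡 n) θ q).inverse (mvfderiv (𝓡 n) θ p v),
    isSmoothVF_inverse G.rep.mem_atlas G.source_eq contMDiff_const,
    inverse_mvfderiv_chart G.rep.mem_atlas (G.mem_source p) v⟩

theorem mvfderiv_mul_self {x : X} (hx : ContMDiff (𝓡 n) 𝓘(ℝ) ∞ (fun p : M => dens p x)) (p : M)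
    (v : TangentSpace (𝓡 n) p) :
    mvfderiv (𝓡 n) (fun q => τ (dens q x)) p v
        * mvfderiv (𝓡 n) (fun q => ellFun h τ (dens q x)) p v
      = deriv τ (dens p x) * τ (dens p x) / lam
        * mvfderiv (𝓡 n) (fun q => ellFun h τ (dens q x)) p v ^ 2 := by
  have h1 := G.tau_mul_mvfderiv_ellFun_dens hx p v
  have h2 := G.lam_pos.ne'
  rw [G.mvfderiv_tau_dens hx]
  field_simp
  linear_combination -deriv τ (dens p x) *
    mvfderiv (𝓡 n) (fun q => ellFun h τ (dens q x)) p v * h1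

theorem ne_zero_measure [Nonempty M] : μ ≠ 0 := by
  rintro rfl
  obtain ⟨p⟩ := ‹Nonempty M›
  have := G.fam.integral_eq_one p
  simp at this

theorem mul_self_nonneg {x : X} (hx : ContMDiff (𝓡 n) 𝓘(ℝ) ∞ (fun p : M => dens p x)) (p : M)
    (v : TangentSpace (𝓡 n) p) :
    0 ≤ mvfderiv (𝓡 n) (fun q => τ (dens q x)) p v
        * mvfderiv (𝓡 n) (fun q => ellFun h τ (dens q x)) p v := by
  rw [G.mvfderiv_mul_self hx]
  have h1 := G.adm.deriv_tau_pos _ (G.dens_mem p x)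
  have h2 := G.tau_pos p x
  have h3 := G.lam_pos
  positivity

/-- If it vanished, the integral of a positive multiple of `(V(ℓ∘e_x))²` would be zero, so `V(ℓ∘e_x)
= 0` almost everywhere. This function is continuous in `x` because `T` is, and full support makes it
vanish everywhere; then `V` kills every smooth `e_x`, so `V p = 0`. -/
theorem coordHess_self_ne_zero [OpensMeasurableSpace X] [μ.IsOpenPosMeasure] (p : M)
    {v : TangentSpace (𝓡 n) p}
    (hv : v ≠ 0) : coordHess θ ψ p v v ≠ 0 := by
  intro h0
  obtain ⟨V, hV, rfl⟩ := G.exists_isSmoothVF p v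
  have h1 := (G.integrable_tau_mul_coordHess hV hV p).2
  rw [h0, mul_zero, G.gForm_eq_integral] at h1
  have h2 := (integral_eq_zero_iff_of_nonneg_ae
    (by filter_upwards [G.ae_contMDiff] with x hx using G.mul_self_nonneg hx p (V p))
    (G.integrable_mvfderiv_mul hV hV p)).1 h1
  have h3 : (fun x => mvfderiv (𝓡 n) (fun q => ellFun h τ (dens q x)) p (V p)) =ᵐ[μ] 0 := by
    filter_upwards [h2, G.ae_contMDiff] with x hx hx'
    have h4 := G.adm.deriv_tau_pos _ (G.dens_mem p x)
    have h5 := G.tau_pos p x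
    have h6 := G.lam_pos
    rw [G.mvfderiv_mul_self hx', Pi.zero_apply] at hx
    have h7 : deriv τ (dens p x) * τ (dens p x) / lam ≠ 0 := by positivity
    simpa [h7] using hx
  have h4 : Continuous fun x => mvfderiv (𝓡 n) (fun q => ellFun h τ (dens q x)) p (V p) := by
    simp only [G.mvfderiv_ellFun_dens]
    exact (continuous_const.inner G.rep.continuous_T).sub continuous_const
  have h5 := (h4.ae_eq_iff_eq μ continuous_zero).1 h3
  obtain ⟨N, -, -, hsm, -, hker⟩ := G.fam.exists_null
  refine hv ((hker p (V p)).1 fun x hx => ?_)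
  have h6 := G.tau_mul_mvfderiv_ellFun_dens (hsm x hx) p (V p)
  rw [show mvfderiv (𝓡 n) (fun q => ellFun h τ (dens q x)) p (V p) = 0 from congrFun h5 x,
    mul_zero] at h6
  simpa [G.lam_pos.ne'] using h6.symm

section Mean

variable [OpensMeasurableSpace X] [μ.IsOpenPosMeasure] (hn : 0 < n)
include hn

omit [OpensMeasurableSpace X] [μ.IsOpenPosMeasure] in
theorem coordVF_ne_zero (p : M) : coordVF θ ⟨0, hn⟩ p ≠ 0 := by
  intro h0
  have h1 := mvfderiv_chart_inverse G.rep.mem_atlas (G.mem_source p)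
    (EuclideanSpace.single (⟨0, hn⟩ : Fin n) (1 : ℝ))
  rw [coordVF] at h0
  rw [h0, map_zero] at h1
  have h2 := congrArg (fun v : EuclideanSpace ℝ (Fin n) => v ⟨0, hn⟩) h1
  simp at h2

/-- Positive dimension supplies a nonzero vector, and the nonzero constant `Hess ψ(v,v)` can be
cancelled from an integrable product. -/
theorem integrable_tau (p : M) : Integrable (fun x => τ (dens p x)) μ := by
  have hV := isSmoothVF_coordVF G.rep.mem_atlas G.source_eq ⟨0, hn⟩
  have h1 := (G.integrable_tau_mul_coordHess hV hV p).1
  have h2 := G.coordHess_self_ne_zero p (G.coordVF_ne_zero hn p)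
  exact (integrable_mul_const_iff (IsUnit.mk0 _ h2) _).1 h1

theorem meanFun_pos (p : M) : 0 < meanFun μ dens τ p := by
  have hM : Nonempty M := ⟨p⟩
  refine (integral_pos_iff_support_of_nonneg (fun x => (G.tau_pos p x).le)
    (G.integrable_tau hn p)).2 ?_
  rw [show Function.support (fun x => τ (dens p x)) = univ from
    eq_univ_of_forall fun x => (G.tau_pos p x).ne']
  exact Measure.measure_univ_pos.2 G.ne_zero_measure

theorem coordHess_pos (p : M) {v : TangentSpace (𝓡 n) p} (hv : v ≠ 0) :
    0 < coordHess θ ψ p v v := by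
  have h0 := G.coordHess_self_ne_zero p hv
  obtain ⟨V, hV, rfl⟩ := G.exists_isSmoothVF p v
  have h1 := (G.integrable_tau_mul_coordHess hV hV p).2
  have h2 : 0 ≤ gForm μ h τ dens V V p := by
    rw [G.gForm_eq_integral]
    refine integral_nonneg_of_ae ?_
    filter_upwards [G.ae_contMDiff] with x hx using G.mul_self_nonneg hx p (V p)
  rw [h1] at h2
  exact lt_of_le_of_ne (nonneg_of_mul_nonneg_right h2 (G.meanFun_pos hn p)) h0.symm

theorem contMDiff_meanFun : ContMDiff (𝓡 n) 𝓘(ℝ) ∞ (meanFun μ dens τ) := by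
  have hV := isSmoothVF_coordVF G.rep.mem_atlas G.source_eq ⟨0, hn⟩
  have h0 : ∀ p, coordHess θ ψ p (coordVF θ ⟨0, hn⟩ p) (coordVF θ ⟨0, hn⟩ p) ≠ 0 := fun p =>
    G.coordHess_self_ne_zero p (G.coordVF_ne_zero hn p)
  have h1 : meanFun μ dens τ = fun p => gForm μ h τ dens (coordVF θ ⟨0, hn⟩)
      (coordVF θ ⟨0, hn⟩) p / coordHess θ ψ p (coordVF θ ⟨0, hn⟩ p) (coordVF θ ⟨0, hn⟩ p) := by
    funext p
    rw [(G.integrable_tau_mul_coordHess hV hV p).2, mul_div_cancel_right₀ _ (h0 p)]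
  rw [h1]
  exact (G.comp.smooth_metric _ _ hV hV).div₀ (G.contMDiff_coordHess hV hV) h0

/-- Let `v` be the tangent vector at `p` with coordinates `θ p - θ q`. Then `ℓ(e_x p) - ℓ(e_x q)` is
`v(ℓ∘e_x)` plus the Bregman term of `ψ`; multiplied by `τ(e_x p)` the first part becomes `λ v(e_x)`,
which integrates to zero, as does `λ(p - q)`. -/
theorem integral_dFun (p q : M) :
    Integrable (fun x => dFun h τ (dens p x) (dens q x)) μ ∧
    ∫ x, dFun h τ (dens p x) (dens q x) ∂μ = meanFun μ dens τ p * (ψ q - ψ p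
      + mvfderiv (𝓡 n) ψ p ((mvfderiv (𝓡 n) θ p).inverse (θ p - θ q))) := by
  set v := (mvfderiv (𝓡 n) θ p).inverse (θ p - θ q) with hv
  have h1 := (G.fam.integrable_dir p v).const_mul lam
  have h2 := (G.integrable_tau hn p).mul_const (ψ q - ψ p + mvfderiv (𝓡 n) ψ p v)
  have h3 : Integrable (fun x => lam * (dens p x - dens q x)) μ :=
    ((G.fam.integrable p).sub (G.fam.integrable q)).const_mul lam
  have h4 : (fun x => dFun h τ (dens p x) (dens q x)) =ᵐ[μ] fun x =>
      lam * mvfderiv (𝓡 n) (fun q => dens q x) p v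
      + τ (dens p x) * (ψ q - ψ p + mvfderiv (𝓡 n) ψ p v) - lam * (dens p x - dens q x) := by
    filter_upwards [G.ae_contMDiff] with x hx
    have h5 := G.tau_mul_mvfderiv_ellFun_dens hx p v
    have h6 := G.mvfderiv_ellFun_dens p x v
    rw [hv, mvfderiv_chart_inverse G.rep.mem_atlas (G.mem_source p), ← hv, inner_sub_left] at h6
    rw [G.adm.dFun_eq G.tau_div_chi (G.dens_mem p x) (G.dens_mem q x), ← h5, h6, G.ellFun_dens,
      G.ellFun_dens]
    ring
  refine ⟨((h1.add h2).sub h3).congr h4.symm, ?_⟩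
  rw [integral_congr_ae h4, integral_add_sub h1 h2 h3, integral_const_mul,
    integral_const_mul, integral_mul_const, G.fam.integral_dir,
    integral_sub (G.fam.integrable p) (G.fam.integrable q), G.fam.integral_eq_one,
    G.fam.integral_eq_one, meanFun]
  ring

theorem divergence_eq (p q : M) : divergence μ h τ dens p q = ENNReal.ofReal
    (∫ x, dFun h τ (dens p x) (dens q x) ∂μ) :=
  (ofReal_integral_eq_lintegral_ofReal (G.integral_dFun hn p q).1 (Filter.Eventually.of_forall
    fun x => G.adm.dFun_nonneg (G.dens_mem p x) (G.dens_mem q x))).symm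

theorem toReal_divergence (p q : M) : (divergence μ h τ dens p q).toReal =
    meanFun μ dens τ p * (ψ q - ψ p
      + mvfderiv (𝓡 n) ψ p ((mvfderiv (𝓡 n) θ p).inverse (θ p - θ q))) := by
  rw [G.divergence_eq hn, ENNReal.toReal_ofReal, (G.integral_dFun hn p q).2]
  exact integral_nonneg fun x => G.adm.dFun_nonneg (G.dens_mem p x) (G.dens_mem q x)

theorem isContrastFunction : IsContrastFunction n (divergence μ h τ dens) where
  ne_top p q := by rw [G.divergence_eq hn]; exact ENNReal.ofReal_ne_top
  eq_zero_iff p q := by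
    have hnn := fun x => G.adm.dFun_nonneg (G.dens_mem p x) (G.dens_mem q x)
    rw [G.divergence_eq hn, ENNReal.ofReal_eq_zero]
    constructor
    · intro h0
      have h1 := le_antisymm h0 (integral_nonneg hnn)
      have h2 := (integral_eq_zero_iff_of_nonneg hnn (G.integral_dFun hn p q).1).1 h1
      refine G.fam.injective p q ?_
      filter_upwards [h2] with x hx
      by_contra hne
      exact (G.adm.dFun_pos (G.dens_mem p x) (G.dens_mem q x) hne).ne' hx
    · rintro rfl
      simp [dFun]
  smooth := by
    have hθ := G.rep.mem_atlas
    have hs := G.source_eq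
    have hθs := contMDiff_chart hθ hs
    have h1 : (fun z : M × M => (divergence μ h τ dens z.1 z.2).toReal) = fun z =>
        meanFun μ dens τ z.1 * (ψ z.2 - ψ z.1
          + fderiv ℝ (fun y => ψ (θ.symm y)) (θ z.1) (θ z.1 - θ z.2)) := by
      funext z
      rw [G.toReal_divergence hn, mvfderiv_eq_fderiv_symm hθ (G.mem_source _)
        (G.contMDiff_psi.mdifferentiableAt (by simp)), mvfderiv_chart_inverse hθ (G.mem_source _)]
    rw [h1]
    have h2 : ContMDiff (𝓡 n) 𝓘(ℝ, EuclideanSpace ℝ (Fin n) →L[ℝ] ℝ) ∞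
        (fun p => fderiv ℝ (fun y => ψ (θ.symm y)) (θ p)) := fun p =>
      ((contDiffAt_comp_symm hθ hs G.contMDiff_psi p).fderiv_right (m := ∞)
        (by simp)).contMDiffAt.comp p (hθs p)
    exact ((G.contMDiff_meanFun hn).comp contMDiff_fst).mul
      (((G.contMDiff_psi.comp contMDiff_snd).sub (G.contMDiff_psi.comp contMDiff_fst)).add
        ((h2.comp contMDiff_fst).clm_apply ((hθs.comp contMDiff_fst).sub (hθs.comp contMDiff_snd))))

end Mean

/-- Splitting `Z(V(ℓ∘e_x))` yields a metric term in `D_Z V` and a multiple of `∫ W(τ∘e_x)`. Only the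
latter needs the exchange of derivative and integral. -/
theorem connForm_eq (hexch : MeanTauExchange n μ τ dens) {Z V W : ∀ p : M, TangentSpace (𝓡 n) p}
    (hZ : IsSmoothVF Z) (hV : IsSmoothVF V) (hW : IsSmoothVF W) (p : M) :
    connForm μ h τ dens Z V W p
      = meanFun μ dens τ p * coordHess θ ψ p (W p) (flatDeriv θ V p (Z p))
        - coordHess θ ψ p (Z p) (V p) * mvfderiv (𝓡 n) (meanFun μ dens τ) p (W p) := by
  have hD := isSmoothVF_flatDeriv G.rep.mem_atlas G.source_eq hZ hV
  have h1 := G.integrable_mvfderiv_mul hW hD p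
  have h2 : (fun x => -dirSnd Z (dirSnd V (dirFst W (dEval h τ dens x))) (p, p)) =ᵐ[μ] fun x =>
      mvfderiv (𝓡 n) (fun q => τ (dens q x)) p (W p)
        * mvfderiv (𝓡 n) (fun q => ellFun h τ (dens q x)) p (flatDeriv θ V p (Z p))
      - coordHess θ ψ p (Z p) (V p) * mvfderiv (𝓡 n) (fun q => τ (dens q x)) p (W p) := by
    filter_upwards [G.ae_contMDiff] with x hx
    rw [G.dirSnd_dirSnd_dirFst_dEval hx Z V W hV, neg_neg, G.mvfderiv_mvfderiv_ellFun_dens hV]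
    ring
  -- Integrability of this product is not a hypothesis: it is the difference of two terms integrable
  -- by compatibility.
  have h3 : Integrable (fun x => coordHess θ ψ p (Z p) (V p) *
      mvfderiv (𝓡 n) (fun q => τ (dens q x)) p (W p)) μ := by
    refine (h1.sub ((G.comp.integrable_conn Z V W hZ hV hW p).neg)).congr ?_
    filter_upwards [h2] with x hx
    simp only [Pi.sub_apply, Pi.neg_apply, hx]
    ring
  rw [connForm, ← integral_neg, integral_congr_ae h2, integral_sub h1 h3, integral_const_mul,
    ← G.gForm_eq_integral W (fun p => flatDeriv θ V p (Z p)),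
    (G.integrable_tau_mul_coordHess hW hD p).2]
  have h4 := hexch W hW p
  simp only [dir] at h4
  rw [h4]

end IsGlobalFamily

end Integrals

/-! ### Affine charts, and functions with vanishing Hessian -/

section AffineCharts

variable {n : ℕ} {M : Type*} [TopologicalSpace M] [ChartedSpace (EuclideanSpace ℝ (Fin n)) M]
  [IsManifold (𝓡 n) ∞ M]

section Affine

variable {θ : OpenPartialHomeomorph M (EuclideanSpace ℝ (Fin n))}
  (hθ : θ ∈ IsManifold.maximalAtlas (𝓡 n) ∞ M) (hs : θ.source = univ)
  {F : Type*} [NormedAddCommGroup F] [NormedSpace ℝ F]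
include hθ hs

/-- The chart image is open and connected, and there a function with zero derivative is constant. -/
theorem eq_of_mvfderiv_eq_zero [ConnectedSpace M] {f : M → F}
    (hf : ∀ p, MDifferentiableAt (𝓡 n) 𝓘(ℝ, F) f p)
    (hf0 : ∀ p (v : TangentSpace (𝓡 n) p), mvfderiv (𝓡 n) f p v = 0) (p q : M) : f p = f q := by
  have hmem : ∀ p, p ∈ θ.source := fun p => by simp [hs]
  have hconn : IsPreconnected θ.target := by
    rw [← θ.image_source_eq_target, hs]
    exact isPreconnected_univ.image _ ((contMDiff_chart hθ hs).continuous.continuousOn)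
  have hd : ∀ y ∈ θ.target, DifferentiableAt ℝ (fun y => f (θ.symm y)) y := fun y hy => by
    have := mdifferentiableAt_comp_symm hθ (hmem _) (hf (θ.symm y))
    rwa [θ.right_inv hy] at this
  have h0 : ∀ y ∈ θ.target, fderiv ℝ (fun y => f (θ.symm y)) y = 0 := fun y hy => by
    ext w
    have h1 := mvfderiv_eq_fderiv_symm hθ (hmem _) (hf (θ.symm y))
      ((mvfderiv (𝓡 n) θ (θ.symm y)).inverse w)
    rw [hf0, mvfderiv_chart_inverse hθ (hmem _), θ.right_inv hy] at h1
    exact h1.symm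
  have h1 := θ.open_target.is_const_of_fderiv_eq_zero hconn
    (fun y hy => (hd y hy).differentiableWithinAt) h0 (θ.map_source (hmem p))
    (θ.map_source (hmem q))
  simpa only [θ.left_inv (hmem p), θ.left_inv (hmem q)] using h1

theorem sum_smul_coordVF (p : M) (w : EuclideanSpace ℝ (Fin n)) :
    ∑ i, w i • coordVF θ i p = (mvfderiv (𝓡 n) θ p).inverse w := by
  rw [eq_sum_frame hθ hs p ((mvfderiv (𝓡 n) θ p).inverse w),
    mvfderiv_chart_inverse hθ (by simp [hs])]

/-- Rewrites the pairing with `η` as `dΨ` on a tangent vector, so that the chart enters the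
canonical divergence only through that vector. -/
theorem inner_coordVF (Ψ : M → ℝ) (p : M) (w : EuclideanSpace ℝ (Fin n)) :
    inner ℝ w (WithLp.toLp 2 fun i => mvfderiv (𝓡 n) Ψ p (coordVF θ i p))
      = mvfderiv (𝓡 n) Ψ p ((mvfderiv (𝓡 n) θ p).inverse w) := by
  rw [← sum_smul_coordVF hθ hs p w, map_sum, PiLp.inner_apply]
  refine Finset.sum_congr rfl fun i _ => ?_
  rw [map_smul]
  simp [mul_comm]

theorem flatDeriv_inverse_const (w : EuclideanSpace ℝ (Fin n)) (p : M)
    (v : TangentSpace (𝓡 n) p) :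
    flatDeriv θ (fun q => (mvfderiv (𝓡 n) θ q).inverse w) p v = 0 := by
  have h1 : (fun q => mvfderiv (𝓡 n) θ q ((mvfderiv (𝓡 n) θ q).inverse w)) = fun _ => w :=
    funext fun q => mvfderiv_chart_inverse hθ (by simp [hs]) w
  rw [flatDeriv, h1, mvfderiv_const]
  simp

/-- Parallel transport of coordinate differences: two global charts whose coordinate vector fields
are parallel for the same flat connection are related by an affine map. -/
theorem inverse_sub_eq_of_flatDeriv_eq_zero [ConnectedSpace M]
    {ξ : OpenPartialHomeomorph M (EuclideanSpace ℝ (Fin n))}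
    (hξ : ξ ∈ IsManifold.maximalAtlas (𝓡 n) ∞ M) (hξs : ξ.source = univ)
    (hflat : ∀ i j p, flatDeriv θ (coordVF ξ j) p (coordVF ξ i p) = 0) (p q : M) :
    (mvfderiv (𝓡 n) ξ p).inverse (ξ p - ξ q) = (mvfderiv (𝓡 n) θ p).inverse (θ p - θ q) := by
  have hθm : ∀ p, p ∈ θ.source := fun p => by simp [hs]
  have hξm : ∀ p, p ∈ ξ.source := fun p => by simp [hξs]
  -- Parallel fields have constant `θ`-coordinates. The transition map thus has constant derivative
  -- `L`, and `θ - L ∘ ξ` is constant.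
  have h1 : ∀ j p q, mvfderiv (𝓡 n) θ p (coordVF ξ j p) = mvfderiv (𝓡 n) θ q (coordVF ξ j q) := by
    intro j
    refine eq_of_mvfderiv_eq_zero hθ hs (f := fun q => mvfderiv (𝓡 n) θ q (coordVF ξ j q))
      (fun q => (contMDiff_coord hθ hs (isSmoothVF_coordVF hξ hξs j)).mdifferentiableAt
        (by simp)) fun q v => ?_
    have h0 : flatDeriv θ (coordVF ξ j) q v = 0 := by
      rw [eq_sum_frame hξ hξs q v, map_sum]
      exact Finset.sum_eq_zero fun i _ => by rw [map_smul, hflat i j q, smul_zero]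
    rw [← mvfderiv_chart_flatDeriv hθ hs, h0, map_zero]
  have h2 : ∀ (w : EuclideanSpace ℝ (Fin n)) r, mvfderiv (𝓡 n) θ r ((mvfderiv (𝓡 n) ξ r).inverse w)
      = mvfderiv (𝓡 n) θ p ((mvfderiv (𝓡 n) ξ p).inverse w) := by
    intro w r
    rw [← sum_smul_coordVF hξ hξs, ← sum_smul_coordVF hξ hξs, map_sum, map_sum]
    refine Finset.sum_congr rfl fun i _ => ?_
    rw [map_smul, map_smul, h1 i r p]
  set L : EuclideanSpace ℝ (Fin n) →L[ℝ] EuclideanSpace ℝ (Fin n) :=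
    (mvfderiv (𝓡 n) θ p) ∘L (mvfderiv (𝓡 n) ξ p).inverse with hL
  have h3 : θ p - L (ξ p) = θ q - L (ξ q) := by
    have hd1 := fun r => mdifferentiableAt_chart hθ (hθm r)
    have hd2 := fun r => mdifferentiableAt_chart hξ (hξm r)
    have hd3 : ∀ r, MDifferentiableAt (𝓡 n) 𝓘(ℝ, EuclideanSpace ℝ (Fin n)) (fun r => L (ξ r)) r :=
      fun r => L.differentiableAt.mdifferentiableAt.comp r (hd2 r)
    refine eq_of_mvfderiv_eq_zero hθ hs (f := fun r => θ r - L (ξ r))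
      (fun r => (hd1 r).sub (hd3 r)) (fun r v => ?_) p q
    rw [show (fun r => θ r - L (ξ r)) = (θ : M → EuclideanSpace ℝ (Fin n)) - fun r => L (ξ r)
      from rfl, mvfderiv_sub (hd1 r) (hd3 r), sub_apply,
      mvfderiv_comp_fderiv L.differentiableAt (hd2 r), ContinuousLinearMap.fderiv, hL,
      ContinuousLinearMap.comp_apply, ← h2 _ r, inverse_mvfderiv_chart hξ (hξm r), sub_self]
  have h4 : θ p - θ q = mvfderiv (𝓡 n) θ p ((mvfderiv (𝓡 n) ξ p).inverse (ξ p - ξ q)) := by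
    change _ = L (ξ p - ξ q)
    rw [map_sub]
    exact sub_eq_sub_iff_sub_eq_sub.1 h3
  rw [h4, inverse_mvfderiv_chart hθ (hθm p)]

/-- The Bregman divergence of a function with vanishing coordinate Hessian vanishes. -/
theorem sub_eq_of_coordHess_eq_zero [ConnectedSpace M] {f : M → ℝ}
    (hf : ContMDiff (𝓡 n) 𝓘(ℝ) ∞ f)
    (hf0 : ∀ p (v w : TangentSpace (𝓡 n) p), coordHess θ f p v w = 0) (p q : M) :
    f q - f p + mvfderiv (𝓡 n) f p ((mvfderiv (𝓡 n) θ p).inverse (θ p - θ q)) = 0 := by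
  have hm : ∀ p, p ∈ θ.source := fun p => by simp [hs]
  have hsm := fun w => isSmoothVF_inverse hθ hs (contMDiff_const (c := w) (I := 𝓡 n) (M := M))
  have h1 : ∀ (w : EuclideanSpace ℝ (Fin n)) r, mvfderiv (𝓡 n) f r
      ((mvfderiv (𝓡 n) θ r).inverse w) = mvfderiv (𝓡 n) f p
      ((mvfderiv (𝓡 n) θ p).inverse w) := by
    intro w r
    refine eq_of_mvfderiv_eq_zero hθ hs
      (f := fun r => mvfderiv (𝓡 n) f r ((mvfderiv (𝓡 n) θ r).inverse w))
      (fun r => (contMDiff_mvfderiv_apply hθ hs hf (hsm w)).mdifferentiableAt (by simp))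
      (fun r v => ?_) r p
    rw [mvfderiv_mvfderiv hθ hs hf (hsm w), hf0, flatDeriv_inverse_const hθ hs]
    simp
  set L : EuclideanSpace ℝ (Fin n) →L[ℝ] ℝ :=
    (mvfderiv (𝓡 n) f p) ∘L (mvfderiv (𝓡 n) θ p).inverse with hL
  have hd1 := fun r => hf.mdifferentiableAt (x := r) (by simp)
  have hd2 := fun r => mdifferentiableAt_chart hθ (hm r)
  have hd3 : ∀ r, MDifferentiableAt (𝓡 n) 𝓘(ℝ) (fun r => L (θ r)) r :=
    fun r => L.differentiableAt.mdifferentiableAt.comp r (hd2 r)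
  have h3 := eq_of_mvfderiv_eq_zero hθ hs (f := fun r => f r - L (θ r))
      (fun r => (hd1 r).sub (hd3 r)) (fun r v => by
    rw [show (fun r => f r - L (θ r)) = f - fun r => L (θ r)
      from rfl, mvfderiv_sub (hd1 r) (hd3 r), sub_apply,
      mvfderiv_comp_fderiv L.differentiableAt (hd2 r), ContinuousLinearMap.fderiv, hL,
      ContinuousLinearMap.comp_apply, ← h1 _ r, inverse_mvfderiv_chart hθ (hm r), sub_self]) p q
  change f q - f p + L (θ p - θ q) = 0
  rw [map_sub]
  linear_combination -h3

end Affine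

end AffineCharts

/-! ### The induced pair and its 1-conformal modification -/

section HessianStructures

variable {n : ℕ} {M : Type*} [TopologicalSpace M] [ChartedSpace (EuclideanSpace ℝ (Fin n)) M]
  [IsManifold (𝓡 n) ∞ M] {X : Type*} [MeasurableSpace X] [TopologicalSpace X]

theorem isInvertible_of_pos {E : Type*} [NormedAddCommGroup E] [NormedSpace ℝ E]
    [FiniteDimensional ℝ E] (B : E →L[ℝ] E →L[ℝ] ℝ) (hB : ∀ v, v ≠ 0 → B v v ≠ 0) :
    ∃ e : E ≃L[ℝ] (E →L[ℝ] ℝ), (e : E →L[ℝ] E →L[ℝ] ℝ) = B := by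
  have hinj : Function.Injective B := by
    rw [injective_iff_map_eq_zero]
    intro v hv
    by_contra hv0
    exact hB v hv0 (by rw [hv]; rfl)
  have hrank : Module.finrank ℝ E = Module.finrank ℝ (E →L[ℝ] ℝ) :=
    Subspace.dual_finrank_eq.symm.trans
      (LinearMap.toContinuousLinearMap (𝕜 := ℝ) (E := E) (F' := ℝ)).finrank_eq
  refine ⟨(LinearMap.linearEquivOfInjective (B : E →ₗ[ℝ] E →L[ℝ] ℝ) hinj
    hrank).toContinuousLinearEquiv, ?_⟩
  ext v w
  rfl

namespace IsGlobalFamily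

variable {μ : Measure X} {h τ : ℝ → ℝ} {I : Set ℝ} {dens : M → X → ℝ}
  {θ : OpenPartialHomeomorph M (EuclideanSpace ℝ (Fin n))}
  {T : X → EuclideanSpace ℝ (Fin n)} {c : X → ℝ} {ψ : M → ℝ} {lam : ℝ}
  [OpensMeasurableSpace X] [μ.IsOpenPosMeasure]
  (G : IsGlobalFamily μ h τ I dens θ T c ψ lam)

/-- The Hessian metric of the normalization `ψ` in the coordinates `θ`. -/
def hessMetric (hn : 0 < n) : Metric n M :=
  metricOfChart G.rep.mem_atlas G.source_eq (coordHess θ ψ)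
    (coordHess_symm G.rep.mem_atlas G.source_eq G.contMDiff_psi)
    (fun p _ hv => G.coordHess_pos hn p hv)
    (fun i j => G.contMDiff_coordHess (isSmoothVF_coordVF G.rep.mem_atlas G.source_eq i)
      (isSmoothVF_coordVF G.rep.mem_atlas G.source_eq j))

/-- The metric `𝕀_τ · Hess ψ`. -/
def inducedMetric (hn : 0 < n) : Metric n M :=
  metricOfChart G.rep.mem_atlas G.source_eq (fun p => meanFun μ dens τ p • coordHess θ ψ p)
    (fun p v w => congrArg (meanFun μ dens τ p * ·)
      (coordHess_symm G.rep.mem_atlas G.source_eq G.contMDiff_psi p v w))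
    (fun p _ hv => mul_pos (G.meanFun_pos hn p) (G.coordHess_pos hn p hv))
    (fun i j => (G.contMDiff_meanFun hn).mul
      (G.contMDiff_coordHess (isSmoothVF_coordVF G.rep.mem_atlas G.source_eq i)
        (isSmoothVF_coordVF G.rep.mem_atlas G.source_eq j)))

include G in
/-- The gradient of a function with respect to the Hessian metric. -/
theorem exists_gradient {f : M → ℝ} (hf : ContMDiff (𝓡 n) 𝓘(ℝ) ∞ f) :
    ∃ V : ∀ p : M, TangentSpace (𝓡 n) p, IsSmoothVF V ∧
      ∀ p w, coordHess θ ψ p (V p) w = mvfderiv (𝓡 n) f p w := by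
  have hθ := G.rep.mem_atlas
  have hs := G.source_eq
  set B : M → EuclideanSpace ℝ (Fin n) →L[ℝ] EuclideanSpace ℝ (Fin n) →L[ℝ] ℝ :=
    fun p => fderiv ℝ (fderiv ℝ (fun y => ψ (θ.symm y))) (θ p) with hB
  set L : M → EuclideanSpace ℝ (Fin n) →L[ℝ] ℝ :=
    fun p => fderiv ℝ (fun y => f (θ.symm y)) (θ p) with hL
  have hinv : ∀ p, ∃ e : EuclideanSpace ℝ (Fin n) ≃L[ℝ] (EuclideanSpace ℝ (Fin n) →L[ℝ] ℝ),
      (e : EuclideanSpace ℝ (Fin n) →L[ℝ] EuclideanSpace ℝ (Fin n) →L[ℝ] ℝ) = B p := fun p => by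
    refine isInvertible_of_pos (B p) fun v hv => ?_
    have h1 := G.coordHess_self_ne_zero p (v := (mvfderiv (𝓡 n) θ p).inverse v) fun h0 => hv (by
      rw [← mvfderiv_chart_inverse hθ (G.mem_source p) v, h0, map_zero])
    rwa [coordHess_apply, mvfderiv_chart_inverse hθ (G.mem_source p)] at h1
  have hBs : ContMDiff (𝓡 n) 𝓘(ℝ, EuclideanSpace ℝ (Fin n) →L[ℝ]
      EuclideanSpace ℝ (Fin n) →L[ℝ] ℝ) ∞ B := fun p =>
    (((contDiffAt_comp_symm hθ hs G.contMDiff_psi p).fderiv_right (m := ∞)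
      (by simp)).fderiv_right (m := ∞) (by simp)).contMDiffAt.comp p (contMDiff_chart hθ hs p)
  have hLs : ContMDiff (𝓡 n) 𝓘(ℝ, EuclideanSpace ℝ (Fin n) →L[ℝ] ℝ) ∞ L := fun p =>
    ((contDiffAt_comp_symm hθ hs hf p).fderiv_right (m := ∞)
      (by simp)).contMDiffAt.comp p (contMDiff_chart hθ hs p)
  -- Inversion of operators is smooth at invertible ones, and `B p` is invertible because its
  -- quadratic form has no nontrivial zero.
  have hBi : ContMDiff (𝓡 n) 𝓘(ℝ, (EuclideanSpace ℝ (Fin n) →L[ℝ] ℝ) →L[ℝ]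
      EuclideanSpace ℝ (Fin n)) ∞ (fun p => (B p).inverse) := fun p => by
    obtain ⟨e, he⟩ := hinv p
    have h1 := contDiffAt_map_inverse (n := ∞) e
    rw [he] at h1
    exact h1.contMDiffAt.comp p (hBs p)
  refine ⟨fun p => (mvfderiv (𝓡 n) θ p).inverse ((B p).inverse (L p)),
    isSmoothVF_inverse hθ hs (hBi.clm_apply hLs), fun p w => ?_⟩
  rw [coordHess_apply, mvfderiv_chart_inverse hθ (G.mem_source p)]
  obtain ⟨e, he⟩ := hinv p
  have h1 : B p ((B p).inverse (L p)) = L p := by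
    rw [← he]; simp
  change B p ((B p).inverse (L p)) _ = _
  rw [h1, hL, mvfderiv_eq_fderiv_symm hθ (G.mem_source p) (hf.mdifferentiableAt (by simp))]

include G in
theorem dir_log_inv_meanFun (hn : 0 < n) (Z : ∀ p : M, TangentSpace (𝓡 n) p) (p : M) :
    dir Z (fun q => Real.log (1 / meanFun μ dens τ q)) p
      = -(mvfderiv (𝓡 n) (meanFun μ dens τ) p (Z p) / meanFun μ dens τ p) := by
  have h0 := (G.meanFun_pos hn p).ne'
  simp only [one_div, Real.log_inv, dir]
  rw [mvfderiv_comp_fderiv (G := fun r => -Real.log r) (Real.differentiableAt_log h0).neg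
    ((G.contMDiff_meanFun hn).mdifferentiableAt (by simp)), fderiv_eq_smul_deriv, deriv.fun_neg,
    Real.deriv_log]
  simp [div_eq_mul_inv]

include G in
/-- The metric and the connection induced by the divergence exist, and so do their
1-conformal modifications. -/
theorem exists_inducedPair (hn : 0 < n) (hexch : MeanTauExchange n μ τ dens) :
    ∃ (g : Metric n M) (conn : Conn n M), IsInducedPair μ h τ dens g conn ∧
      ∃ (g' : Metric n M) (conn' : Conn n M),
        IsOneConformal (fun p => 1 / meanFun μ dens τ p) g conn g' conn' := by
  have hθ := G.rep.mem_atlas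
  have hs := G.source_eq
  have hm := G.contMDiff_meanFun hn
  have hpos := G.meanFun_pos hn
  have hsymm := coordHess_symm hθ hs G.contMDiff_psi
  obtain ⟨N, hN, hNeq⟩ := G.exists_gradient hm
  -- `N` is the gradient of `𝕀_τ` for `Hess ψ`. Correcting `D` by `-Hess ψ(V,W) 𝕀_τ⁻¹ N` reproduces
  -- the term `-Hess ψ(V,W) Z(𝕀_τ)` of `connForm_eq`.
  let A : ∀ p : M, TangentSpace (𝓡 n) p →L[ℝ] TangentSpace (𝓡 n) p →L[ℝ] TangentSpace (𝓡 n) p :=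
    fun p => ContinuousLinearMap.postcomp (TangentSpace (𝓡 n) p)
      (ContinuousLinearMap.toSpanSingleton ℝ (-(meanFun μ dens τ p)⁻¹ • N p)) ∘L coordHess θ ψ p
  have hA : ∀ p v w, A p v w = coordHess θ ψ p v w • (-(meanFun μ dens τ p)⁻¹ • N p) :=
    fun p v w => rfl
  let conn : Conn n M := (flatConn hθ hs).addOneForm A
  have hconn : ∀ W p v, conn W p v = flatDeriv θ W p v + A p (W p) v := fun W p v => rfl
  have hinv : ContMDiff (𝓡 n) 𝓘(ℝ) ∞ fun p => (meanFun μ dens τ p)⁻¹ :=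
    hm.inv₀ fun p => (hpos p).ne'
  refine ⟨G.inducedMetric hn, conn, ⟨?_, ?_, ?_⟩, G.hessMetric hn, flatConn hθ hs,
    ⟨?_, ?_, ?_, ?_⟩⟩
  · refine contMDiffCovariantDerivative_of_smooth hθ hs conn fun V W hV hW => ?_
    simp only [hconn, hA]
    exact ContMDiff.add_section (isSmoothVF_flatDeriv hθ hs hV hW)
      (ContMDiff.smul_section (G.contMDiff_coordHess hW hV) (ContMDiff.smul_section hinv.neg hN))
  · intro V W hV hW p
    exact (G.integrable_tau_mul_coordHess hV hW p).2.symm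
  · intro Z V W hZ hV hW p
    rw [G.connForm_eq hexch hZ hV hW, hconn, hA]
    change meanFun μ dens τ p * coordHess θ ψ p (_ + _) (W p) = _
    rw [map_add, add_apply, map_smul, smul_apply, map_smul, smul_apply, hNeq,
      hsymm p (W p), hsymm p (V p)]
    simp only [smul_eq_mul]
    have := (hpos p).ne'
    field_simp
    ring
  · simpa only [one_div] using hinv
  · exact fun p => one_div_pos.2 (hpos p)
  · intro p v w
    change coordHess θ ψ p v w = 1 / meanFun μ dens τ p * (meanFun μ dens τ p
      * coordHess θ ψ p v w)
    have := (hpos p).ne'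
    field_simp
  · intro V W Z hV hW hZ p
    rw [G.dir_log_inv_meanFun hn, hconn, hA, flatConn_apply]
    change coordHess θ ψ p _ (Z p) = coordHess θ ψ p (_ + _) (Z p) - _ *
      coordHess θ ψ p (V p) (W p)
    rw [map_add, add_apply, map_smul, smul_apply, map_smul, smul_apply, hNeq, hsymm p (W p)]
    simp only [smul_eq_mul]
    ring

/-! ### Identification of every admissible pair with `(Hess ψ, D)` -/

section Uniqueness

variable (hn : 0 < n) (hexch : MeanTauExchange n μ τ dens) {g g' : Metric n M}
  {conn conn' : Conn n M} (hind : IsInducedPair μ h τ dens g conn)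
  (hconf : IsOneConformal (fun p => 1 / meanFun μ dens τ p) g conn g' conn')
include G hn hind hconf

theorem metric_eq_coordHess (p : M) (v w : TangentSpace (𝓡 n) p) :
    g'.inner p v w = coordHess θ ψ p v w := by
  obtain ⟨V, hV, rfl⟩ := G.exists_isSmoothVF p v
  obtain ⟨W, hW, rfl⟩ := G.exists_isSmoothVF p w
  rw [hconf.metric_eq, hind.metric_eq V W hV hW, (G.integrable_tau_mul_coordHess hV hW p).2]
  have := (G.meanFun_pos hn p).ne'
  field_simp

include hexch

/-- The conformal correction `-Z(log(1/𝕀_τ)) = Z(𝕀_τ)/𝕀_τ` cancels the non-flat term of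
`connForm_eq`; the metric being definite, equality of all pairings suffices. -/
theorem conn_eq_flatDeriv {W : ∀ p : M, TangentSpace (𝓡 n) p} (hW : IsSmoothVF W) (p : M)
    (v : TangentSpace (𝓡 n) p) : conn' W p v = flatDeriv θ W p v := by
  obtain ⟨V, hV, rfl⟩ := G.exists_isSmoothVF p v
  have hsymm := coordHess_symm G.rep.mem_atlas G.source_eq G.contMDiff_psi
  have hg := G.metric_eq_coordHess hn hind hconf
  have h0 := (G.meanFun_pos hn p).ne'
  have key : ∀ z, g'.inner p (conn' W p (V p)) z = g'.inner p (flatDeriv θ W p (V p)) z := by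
    intro z
    obtain ⟨Z, hZ, rfl⟩ := G.exists_isSmoothVF p z
    rw [hconf.conn_eq V W Z hV hW hZ p, hconf.metric_eq p (conn W p (V p)),
      hind.conn_eq V W Z hV hW hZ p, G.connForm_eq hexch hV hW hZ, G.dir_log_inv_meanFun hn,
      hg, hg, hsymm p (Z p)]
    field_simp
    ring
  by_contra hne
  have h1 := g'.pos p _ (sub_ne_zero.2 hne)
  have h2 := key (conn' W p (V p) - flatDeriv θ W p (V p))
  rw [g'.symm, g'.symm p (flatDeriv θ W p (V p))] at h2
  rw [map_sub, h2, sub_self] at h1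
  exact lt_irrefl _ h1

theorem isPotentialOn : IsPotentialOn g' conn' ψ univ where
  smooth := G.contMDiff_psi.contMDiffOn
  eq_hess V W hV hW p _ := by
    rw [G.metric_eq_coordHess hn hind hconf, G.conn_eq_flatDeriv hn hexch hind hconf hW]
    have := mvfderiv_mvfderiv G.rep.mem_atlas G.source_eq G.contMDiff_psi hW p (V p)
    simp only [dir] at this ⊢
    rw [eq_sub_iff_add_eq, ← this]
    rfl

theorem isHessianStructure : IsHessianStructure g' conn' := by
  have hθ := G.rep.mem_atlas
  have hs := G.source_eq
  have hc := fun {W} hW => G.conn_eq_flatDeriv hn hexch hind hconf (W := W) hW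
  refine ⟨?_, ⟨?_, ?_⟩, fun p => ⟨univ, isOpen_univ, mem_univ p, ψ,
    G.isPotentialOn hn hexch hind hconf⟩⟩
  · refine contMDiffCovariantDerivative_of_smooth hθ hs conn' fun V W hV hW => ?_
    simp only [hc hW]
    exact isSmoothVF_flatDeriv hθ hs hV hW
  · intro V W hV hW p
    rw [hc hW, hc hV, mlieBracket_eq_flatDeriv hθ hs hV hW, sub_self]
  · intro V W Z hV hW hZ p
    have hZ' := contMDiff_coord hθ hs hZ
    -- In coordinates the iterated derivative of `Z` is a symmetric Hessian plus a derivative along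
    -- `D_{U'} U`; antisymmetrising leaves the derivative along the bracket, so the curvature
    -- vanishes.
    have h1 : ∀ U U' : ∀ p : M, TangentSpace (𝓡 n) p, IsSmoothVF U →
        conn' (fun q => conn' Z q (U q)) p (U' p) = (mvfderiv (𝓡 n) θ p).inverse
          (coordHess θ (fun q => mvfderiv (𝓡 n) θ q (Z q)) p (U' p) (U p)
          + mvfderiv (𝓡 n) (fun q => mvfderiv (𝓡 n) θ q (Z q)) p (flatDeriv θ U p (U' p))) := by
      intro U U' hU
      simp only [hc hZ]
      rw [hc (isSmoothVF_flatDeriv hθ hs hU hZ), flatDeriv, ContinuousLinearMap.comp_apply]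
      simp only [mvfderiv_chart_flatDeriv hθ hs]
      rw [mvfderiv_mvfderiv hθ hs hZ' hU]
    rw [h1 W V hW, h1 V W hV, hc hZ, mlieBracket_eq_flatDeriv hθ hs hV hW, map_sub]
    simp only [flatDeriv, ContinuousLinearMap.comp_apply]
    rw [coordHess_symm hθ hs hZ' p (V p)]
    simp only [map_add]
    abel

/-- The right side is the Bregman divergence of `ψ` in `θ`. Another affine chart `ξ` gives the same
tangent vector for `ξ p - ξ q`, and another potential differs from `ψ` by a function with zero
Hessian, whose Bregman term vanishes. Existence is realised by `θ` and `ψ`. -/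
theorem isCanonicalDivergence_iff [ConnectedSpace M] (D : M → M → ℝ) :
    IsCanonicalDivergence g' conn' D ↔
      ∀ p q, D p q = 1 / meanFun μ dens τ p * (divergence μ h τ dens p q).toReal := by
  have hθ := G.rep.mem_atlas
  have hs := G.source_eq
  have hc := fun {W} hW => G.conn_eq_flatDeriv hn hexch hind hconf (W := W) hW
  have hg := G.metric_eq_coordHess hn hind hconf
  have hdiv : ∀ p q, 1 / meanFun μ dens τ p * (divergence μ h τ dens p q).toReal
      = ψ q - ψ p + mvfderiv (𝓡 n) ψ p ((mvfderiv (𝓡 n) θ p).inverse (θ p - θ q)) := by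
    intro p q
    rw [G.toReal_divergence hn]
    have := (G.meanFun_pos hn p).ne'
    field_simp
  simp only [hdiv]
  constructor
  · rintro ⟨ξ, Ψ, hξ, hξs, hΨ, hD⟩ p q
    have hΨs : ContMDiff (𝓡 n) 𝓘(ℝ) ∞ Ψ := contMDiffOn_univ.1 hΨ.smooth
    have hflat : ∀ i j p, flatDeriv θ (coordVF ξ j) p (coordVF ξ i p) = 0 := fun i j p => by
      rw [← hc (isSmoothVF_coordVF hξ.mem_atlas hξs j)]
      exact hξ.christoffel_eq_zero i j p (by simp [hξs])
    have hΨh : ∀ p v w, coordHess θ Ψ p v w = coordHess θ ψ p v w := by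
      intro p v w
      obtain ⟨V, hV, rfl⟩ := G.exists_isSmoothVF p v
      obtain ⟨W, hW, rfl⟩ := G.exists_isSmoothVF p w
      have h1 := hΨ.eq_hess V W hV hW p (mem_univ p)
      have h2 := mvfderiv_mvfderiv hθ hs hΨs hW p (V p)
      rw [hg, hc hW] at h1
      rw [h1, eq_sub_iff_add_eq, ← h2]
      rfl
    have hsub : ContMDiff (𝓡 n) 𝓘(ℝ) ∞ (Ψ - ψ) := hΨs.sub G.contMDiff_psi
    have h3 := sub_eq_of_coordHess_eq_zero hθ hs hsub (fun p v w => by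
      obtain ⟨W, hW, rfl⟩ := G.exists_isSmoothVF p w
      have e1 := mvfderiv_mvfderiv hθ hs hΨs hW p v
      have e2 := mvfderiv_mvfderiv hθ hs G.contMDiff_psi hW p v
      have e3 := mvfderiv_mvfderiv hθ hs hsub hW p v
      have hd1 := fun r => hΨs.mdifferentiableAt (x := r) (by simp)
      have hd2 := fun r => G.contMDiff_psi.mdifferentiableAt (x := r) (by simp)
      have e4 : (fun q => mvfderiv (𝓡 n) (Ψ - ψ) q (W q)) =
          (fun q => mvfderiv (𝓡 n) Ψ q (W q)) - fun q => mvfderiv (𝓡 n) ψ q (W q) := by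
        funext q
        rw [mvfderiv_sub (hd1 q) (hd2 q)]
        rfl
      rw [e4, mvfderiv_sub ((contMDiff_mvfderiv_apply hθ hs hΨs hW).mdifferentiableAt (by simp))
        ((contMDiff_mvfderiv_apply hθ hs G.contMDiff_psi hW).mdifferentiableAt (by simp)),
        mvfderiv_sub (hd1 p) (hd2 p), sub_apply, sub_apply, e1, e2, hΨh] at e3
      linarith) p q
    rw [mvfderiv_sub (hΨs.mdifferentiableAt (by simp))
      (G.contMDiff_psi.mdifferentiableAt (by simp)), sub_apply] at h3
    rw [hD, inner_coordVF hξ.mem_atlas hξs,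
      inverse_sub_eq_of_flatDeriv_eq_zero hθ hs hξ.mem_atlas hξs hflat]
    simp only [Pi.sub_apply] at h3
    linarith
  · intro hD
    refine ⟨θ, ψ, ⟨hθ, fun i j p _ => ?_⟩, hs, G.isPotentialOn hn hexch hind hconf,
      fun p q => ?_⟩
    · rw [hc (isSmoothVF_coordVF hθ hs j)]
      exact flatDeriv_inverse_const hθ hs _ p _
    · rw [hD, inner_coordVF hθ hs]

end Uniqueness

end IsGlobalFamily

end HessianStructures

end DeformedExp

end

theorem proposition5p6 {X : Type*} [TopologicalSpace X] [MeasurableSpace X] [BorelSpace X]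
    (μ : Measure X) [μ.IsOpenPosMeasure]
    {n : ℕ} (hn : 0 < n)
    {M : Type*} [TopologicalSpace M] [T2Space M] [SecondCountableTopology M] [ConnectedSpace M]
    [ChartedSpace (EuclideanSpace ℝ (Fin n)) M] [IsManifold (𝓡 n) ∞ M]
    (h τ : ℝ → ℝ) (I : Set ℝ) (hadm : IsAdmissible h τ I)
    (dens : M → X → ℝ) (hfam : IsExpFamily n μ h τ I dens) (hcomp : IsCompatible n μ h τ dens)
    (hconst : ∃ lam : ℝ, 0 < lam ∧ ∀ t ∈ I, τ t / chiFun h τ t = lam) :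
    -- `𝕀_τ` is well defined, smooth and positive
    ((∀ p, Integrable (fun x => τ (dens p x)) μ) ∧
      ContMDiff (𝓡 n) 𝓘(ℝ) ∞ (meanFun μ dens τ) ∧
      ∀ p, 0 < meanFun μ dens τ p) ∧
    -- the divergence is a contrast function
    IsContrastFunction n (divergence μ h τ dens) ∧
    -- global representations exist
    (∃ (θ : OpenPartialHomeomorph M (EuclideanSpace ℝ (Fin n)))
        (T : X → EuclideanSpace ℝ (Fin n)) (c : X → ℝ) (ψ : M → ℝ),
        IsExpCoordRep h τ I dens θ T c ψ ∧ θ.source = univ) ∧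
    (MeanTauExchange n μ τ dens →
      -- the metrics and connections `(g, ∇) = (g^{h,τ}, ∇^{h,τ})` and `(g', ∇')` exist
      (∃ (g : Metric n M) (conn : Conn n M), IsInducedPair μ h τ dens g conn ∧
        ∃ (g' : Metric n M) (conn' : Conn n M),
          IsOneConformal (fun p => 1 / meanFun μ dens τ p) g conn g' conn') ∧
      ∀ (g : Metric n M) (conn : Conn n M) (g' : Metric n M) (conn' : Conn n M),
        IsInducedPair μ h τ dens g conn →
        IsOneConformal (fun p => 1 / meanFun μ dens τ p) g conn g' conn' →
        IsHessianStructure g' conn' ∧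
        -- every global normalization is a global potential
        (∀ (θ : OpenPartialHomeomorph M (EuclideanSpace ℝ (Fin n)))
          (T : X → EuclideanSpace ℝ (Fin n)) (c : X → ℝ) (ψ : M → ℝ),
          IsExpCoordRep h τ I dens θ T c ψ → θ.source = univ →
          IsPotentialOn g' conn' ψ univ) ∧
        -- the canonical divergence
        ∀ D : M → M → ℝ, IsCanonicalDivergence g' conn' D ↔
          ∀ p p', D p p' = 1 / meanFun μ dens τ p * (divergence μ h τ dens p p').toReal) := by
  obtain ⟨lam, hlam0, hlam⟩ := hconst
  -- Total mass one forbids an empty `X`; a point of `X` is what determines `ψ` when representations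
  -- are glued.
  have hX : Nonempty X := by
    by_contra hX
    rw [not_nonempty_iff] at hX
    obtain ⟨p⟩ := (inferInstance : Nonempty M)
    have h1 := hfam.integral_eq_one p
    rw [μ.eq_zero_of_isEmpty, integral_zero_measure] at h1
    exact zero_ne_one h1
  have hglob : ∀ (θ : OpenPartialHomeomorph M (EuclideanSpace ℝ (Fin n)))
      (T : X → EuclideanSpace ℝ (Fin n)) (c : X → ℝ) (ψ : M → ℝ),
      IsExpCoordRep h τ I dens θ T c ψ → θ.source = univ →
      IsGlobalFamily μ h τ I dens θ T c ψ lam := fun θ T c ψ hrep hs =>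
    ⟨hadm, hlam0, hlam, hfam, hcomp, hrep, hs⟩
  obtain ⟨θ, T, c, ψ, hrep, hs⟩ :=
    exists_global_rep hadm hfam.toIsDensityFamily hfam.exists_rep
  have G := hglob θ T c ψ hrep hs
  refine ⟨⟨G.integrable_tau hn, G.contMDiff_meanFun hn, G.meanFun_pos hn⟩,
    G.isContrastFunction hn, ⟨θ, T, c, ψ, hrep, hs⟩, fun hexch => ⟨G.exists_inducedPair hn hexch,
      fun g conn g' conn' hind hconf => ⟨G.isHessianStructure hn hexch hind hconf,
        fun θ₁ T₁ c₁ ψ₁ hrep₁ hs₁ => ?_, G.isCanonicalDivergence_iff hn hexch hind hconf⟩⟩⟩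
  exact (hglob θ₁ T₁ c₁ ψ₁ hrep₁ hs₁).isPotentialOn hn hexch hind hconf
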